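/- A temporal graph $\mathbb{G}=(V,E,T)$ consists of a finite vertex set $V$, a time interval $T=[\alpha,\omega]\subseteq\mathbb{N}$ and a set of time-edges $E\subseteq\binom{V}{2}\times T$; $|T|=\omega-\alpha+1$ is the number of time steps. Let $\Delta\in\mathbb{N}$ with $\Delta\le\omega-\alpha$. A $\Delta$-clique is a pair $(C,I)$ with $C\subseteq V$, $I=[a,b]\subseteq T$ and $b-a\ge\Delta$ such that for every $\tau\in[a,b-\Delta]$ and all distinct $v,w\in C$ there is a $(\{v,w\},t)\in E$ with $t\in[\tau,\tau+\Delta]$. It is maximal if there is no $\Delta$-clique $(C',I')$ with $I\subseteq I'$ and $C\subsetneq C'$, and none with $I\subsetneq I'$ and $C\subseteq C'$. The graph $\mathbb{G}$ has $\Delta$-slice degeneracy $d$ if for every $t\in T$ the static graph on $V$, whose edges are the pairs $\{v,w\}$ with $(\{v,w\},t')\in E$ for some $t'\in[t,t+\Delta]$, has degeneracy at most $d$ (every non-empty subgraph has a vertex of degree at most $d$ in it). For $v\in V$ and an interval $I\subseteq T$ let $N^\Delta(v,I)$ be the set of all $(w,I')$ such that $I'=[a',b']$ is an inclusion-maximal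 subinterval of $I$ with $b'-a'\ge\Delta$ and the property that for each $\tau\in[a',b'-\Delta]$ there is a $(\{v,w\},t)\in E$ with $t\in[\tau,\tau+\Delta]$. For sets $P,Y$ of vertex-interval pairs let $P\sqcap Y$ be the set of all $(v,I\cap I')$ with $(v,I)\in P$, $(v,I')\in Y$ and $I\cap I'$ an interval $[a,b]$ with $b-a\ge\Delta$. The recursive procedure BronKerboschDelta$(P,R=(C,I),X)$ adds $R$ to the solution if $I'\subsetneq I$ for all $(w,I')\in P\cup X$; then, for each $(v,I')\in P$ in turn, it calls BronKerboschDelta$(P\sqcap N^\Delta(v,I'),\,(C\cup\{v\},I'),\,X\sqcap N^\Delta(v,I'))$ and moves $(v,I')$ from $P$ to $X$. The initial call has $P=\{(v,T):v\in V\}$, $R=(\emptyset,T)$, $X=\emptyset$. Theorem. Implement BronKerboschDelta with sorted lists of vertex-interval pairs, with $\Delta$-cuts computed by merging and with a preprocessing that sorts the time-edges by time stamp and computes all $N^\Delta(v,T)$, and count unit-cost operations on list cells, array entries, vertices and time stamps, including the preprocessing and the writing of the solution. There is a constant $K$ such that for every temporal graph $\mathbb{G}=(V,E,T)$, given by a list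 of its time-edges, every $\Delta\le\omega-\alpha$ and every $d$ such that $\mathbb{G}$ has $\Delta$-slice degeneracy $d$, the algorithm terminates, its solution contains every maximal $\Delta$-clique of $\mathbb{G}$ exactly once and nothing else, and, if $E\neq\emptyset$, it takes at most $$K\cdot 3^{d/3}\cdot 2^d\cdot|V|\cdot|T|\cdot|E|$$ steps. In particular, the enumeration of all maximal $\Delta$-cliques is fixed-parameter tractable with respect to $d$: there are a computable function $f$ and a constant $c$ such that the algorithm always (also if $E=\emptyset$) takes at most $f(d)\cdot(|V|+|T|+|E|)^c$ steps. -/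

import Mathlib

/-! ## Temporal graphs and `Δ`-cliques

A time interval `[a, b]` of natural numbers (`a ≤ b`) is a `NonemptyInterval ℕ`; its order `≤` is
inclusion of intervals, `<` is strict inclusion, and `a`, `b` are written `I.fst`, `I.snd`. -/

/-- A temporal graph with vertex set `V`: a time interval `T = [α, ω]` of natural numbers and a
finite set `E` of time-edges `({v, w}, t)` with `v ≠ w` and `t ∈ T`. -/
structure TemporalGraph (V : Type*) where
  T : NonemptyInterval ℕ
  E : Finset (Sym2 V × ℕ)
  not_isDiag : ∀ e ∈ E, ¬ e.1.IsDiag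
  time_mem : ∀ e ∈ E, e.2 ∈ T

namespace TemporalGraph

variable {V : Type*}

/-- `|T|`, the number of time steps `ω - α + 1` of the temporal graph. -/
def numTimes (G : TemporalGraph V) : ℕ := (Finset.Icc G.T.fst G.T.snd).card

/-- `(X, I)` with `I = [a, b]` is a `Δ`-clique: `I ⊆ T`, `b - a ≥ Δ`, and for every
`τ ∈ [a, b - Δ]` any two distinct vertices of `X` have a time-edge in `[τ, τ + Δ]`. -/
def IsDeltaClique (G : TemporalGraph V) (Δ : ℕ) (R : Finset V × NonemptyInterval ℕ) : Prop :=
  R.2 ≤ G.T ∧ R.2.fst + Δ ≤ R.2.snd ∧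
    ∀ τ : ℕ, R.2.fst ≤ τ → τ + Δ ≤ R.2.snd →
      ∀ v ∈ R.1, ∀ w ∈ R.1, v ≠ w → ∃ t : ℕ, τ ≤ t ∧ t ≤ τ + Δ ∧ (s(v, w), t) ∈ G.E

/-- No vertex can be added without decreasing the time interval. -/
def IsVertexMaximal (G : TemporalGraph V) (Δ : ℕ) (R : Finset V × NonemptyInterval ℕ) : Prop :=
  ¬ ∃ R' : Finset V × NonemptyInterval ℕ, G.IsDeltaClique Δ R' ∧ R.2 ≤ R'.2 ∧ R.1 ⊂ R'.1

/-- The time interval cannot be increased without removing vertices. -/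
def IsTimeMaximal (G : TemporalGraph V) (Δ : ℕ) (R : Finset V × NonemptyInterval ℕ) : Prop :=
  ¬ ∃ R' : Finset V × NonemptyInterval ℕ, G.IsDeltaClique Δ R' ∧ R.2 < R'.2 ∧ R.1 ⊆ R'.1

/-- A maximal `Δ`-clique: vertex-maximal and time-maximal. -/
def IsMaximalDeltaClique (G : TemporalGraph V) (Δ : ℕ) (R : Finset V × NonemptyInterval ℕ) :
    Prop :=
  G.IsDeltaClique Δ R ∧ G.IsVertexMaximal Δ R ∧ G.IsTimeMaximal Δ R

/-- The `Δ`-slice at time `t`: the static graph on `V` whose edges are the pairs that have a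
time-edge during `[t, t + Δ]`. -/
def slice (G : TemporalGraph V) (Δ t : ℕ) : SimpleGraph V where
  Adj v w := ∃ t' : ℕ, t ≤ t' ∧ t' ≤ t + Δ ∧ (s(v, w), t') ∈ G.E
  symm := ⟨fun v w ⟨t', h₁, h₂, h₃⟩ => ⟨t', h₁, h₂, by rwa [Sym2.eq_swap]⟩⟩
  loopless := ⟨fun v ⟨_, _, _, h⟩ => G.not_isDiag _ h (by simp)⟩

end TemporalGraph

/-- The degeneracy of a (finite) static graph: the smallest `d` such that every non-empty subgraph
contains a vertex whose degree in that subgraph is at most `d`. -/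
noncomputable def SimpleGraph.degeneracy {V : Type*} (G : SimpleGraph V) : ℕ :=
  sInf {d : ℕ | ∀ H : G.Subgraph, H.verts.Nonempty → ∃ v ∈ H.verts, (H.neighborSet v).ncard ≤ d}

/-- The temporal graph has `Δ`-slice degeneracy `d`: for every time step `t ∈ T` the `Δ`-slice at
time `t` has degeneracy at most `d`. -/
def TemporalGraph.HasSliceDegeneracy {V : Type*} (G : TemporalGraph V) (Δ d : ℕ) : Prop :=
  ∀ t ∈ G.T, (G.slice Δ t).degeneracy ≤ d

/-! ## The cost model

Programs are written with explicit step counts. Every call of a program function (so also every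
iteration of a loop, which is written as a recursive call) costs one step; apart from the calls it
makes, its body consists of a bounded number of unit-cost operations: inspecting or prepending to
a linked list, comparing or computing with vertices and time stamps, reading an array entry. -/

/-- The result of a terminating computation together with the number of steps it takes. -/
structure Timed (α : Type) where
  val : α
  cost : ℕ

instance : Monad Timed where
  pure a := ⟨a, 0⟩
  bind x f := ⟨(f x.val).val, x.cost + (f x.val).cost⟩

/-- One step. -/
def step : Timed Unit := ⟨(), 1⟩

/-- Computations with a step counter that can fail (`none`). -/
abbrev Comp := StateT ℕ Option

instance : MonadLift Timed Comp where
  monadLift x := fun c => some (x.val, c + x.cost)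

/-- Fill an array indexed by the vertices, running `f v` for the entry of each `v`. An array is a
function on `Fin n`; reading one entry is a unit-cost operation. -/
def tabulate {n : ℕ} {α : Type} (f : Fin n → Timed α) : Timed (Fin n → α) :=
  ⟨fun v => (f v).val, ∑ v, ((f v).cost + 1)⟩

/-- The list of all vertices, in increasing order. -/
def vertexList (n : ℕ) : Timed (List (Fin n)) := ⟨List.finRange n, n + 1⟩

/-- Concatenation of two lists, linear in the first. -/
def concat {α : Type} : List α → List α → Timed (List α)
  | [], B => do step; pure B
  | a :: A, B => do
    step
    let r ← concat A B
    pure (a :: r)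

/-- Prepends the reversal of the first list to the second, linear in the first. -/
def revConcat {α : Type} : List α → List α → Timed (List α)
  | [], B => do step; pure B
  | a :: A, B => do step; revConcat A (a :: B)

/-! ## Vertex-interval pairs, `Δ`-cuts and `Δ`-neighborhoods -/

/-- A vertex-interval pair. -/
abbrev VIPair (n : ℕ) := Fin n × NonemptyInterval ℕ

/-- Prepends `(v, [a, b])` to `L` if `b - a ≥ Δ`, and discards it otherwise. -/
def consIfLong {n : ℕ} (Δ : ℕ) (v : Fin n) (a b : ℕ) (L : List (VIPair n)) : List (VIPair n) :=
  if h : a + Δ ≤ b then (v, ⟨(a, b), le_trans (Nat.le_add_right a Δ) h⟩) :: L else L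

/-- The `Δ`-cut `X ⊓ Y = {(v, I ∩ I') | (v, I) ∈ X, (v, I') ∈ Y, I ∩ I' of length at least Δ}` of
two lists that are sorted by vertex and then by starting point, computed by merging them; the
result is sorted in the same way. -/
def deltaCut {n : ℕ} (Δ : ℕ) : List (VIPair n) → List (VIPair n) → Timed (List (VIPair n))
  | [], _ => do step; pure []
  | _ :: _, [] => do step; pure []
  | (v, I) :: X, (w, J) :: Y => do
    step
    if v < w then deltaCut Δ X ((w, J) :: Y)
    else if w < v then deltaCut Δ ((v, I) :: X) Y
    else
      let r ← if J.snd < I.snd then deltaCut Δ ((v, I) :: X) Y else deltaCut Δ X ((w, J) :: Y)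
      pure (consIfLong Δ v (max I.fst J.fst) (min I.snd J.snd) r)
termination_by X Y => X.length + Y.length

/-- The `Δ`-cut of a list `X` in decreasing order with a list `Y` in increasing order; the result
is in decreasing order. -/
def deltaCutDesc {n : ℕ} (Δ : ℕ) (X Y : List (VIPair n)) : Timed (List (VIPair n)) :=
  match Y with
  | [] => do step; pure []
  | _ :: _ => do
    step
    let A ← revConcat X []
    let B ← deltaCut Δ A Y
    revConcat B []

/-- Obtains the `Δ`-neighborhood `N(v, I)` from `N(v, T)`: every interval is intersected with `I`,
and kept if it still has length at least `Δ`. -/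
def restrictTo {n : ℕ} (Δ : ℕ) (I : NonemptyInterval ℕ) : List (VIPair n) → Timed (List (VIPair n))
  | [] => do step; pure []
  | (w, J) :: L => do
    step
    let r ← restrictTo Δ I L
    pure (consIfLong Δ w (max I.fst J.fst) (min I.snd J.snd) r)

/-- Inserts a pair into a list in decreasing order (by vertex, then by starting point). -/
def insertDesc {n : ℕ} (p : VIPair n) : List (VIPair n) → Timed (List (VIPair n))
  | [] => do step; pure [p]
  | q :: X => do
    step
    if p.1 < q.1 ∨ (p.1 = q.1 ∧ p.2.fst < q.2.fst) then
      let r ← insertDesc p X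
      pure (q :: r)
    else pure (p :: q :: X)

/-! ## Preprocessing: the array of all `Δ`-neighborhoods `N(v, T)` -/

/-- The time-edges with time stamp `t`. -/
def edgesAt {n : ℕ} (t : ℕ) : List (Fin n × Fin n × ℕ) → Timed (List (Fin n × Fin n × ℕ))
  | [] => do step; pure []
  | e :: es => do
    step
    let r ← edgesAt t es
    pure (if e.2.2 = t then e :: r else r)

/-- Sorts the time-edges with time stamps `t, …, t + k - 1` by their time stamps. -/
def sortByTime {n : ℕ} (es : List (Fin n × Fin n × ℕ)) (t : ℕ) :
    ℕ → Timed (List (Fin n × Fin n × ℕ))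
  | 0 => do step; pure []
  | k + 1 => do
    step
    let a ← edgesAt t es
    let b ← sortByTime es (t + 1) k
    concat a b

/-- The contacts `(w, t)` of the vertex `v`, one for each time-edge `({v, w}, t)`. -/
def contacts {n : ℕ} (v : Fin n) : List (Fin n × Fin n × ℕ) → Timed (List (Fin n × ℕ))
  | [] => do step; pure []
  | (x, y, t) :: es => do
    step
    let r ← contacts v es
    pure (if x = v then (y, t) :: r else if y = v then (x, t) :: r else r)

/-- The time stamps of the contacts with `w`. -/
def contactTimes {n : ℕ} (w : Fin n) : List (Fin n × ℕ) → Timed (List ℕ)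
  | [] => do step; pure []
  | c :: cs => do
    step
    let r ← contactTimes w cs
    pure (if c.1 = w then c.2 :: r else r)

/-- `T` is the lifetime; `a` is the starting point of the current maximal interval, `l` the last
contact seen so far, and the list holds the later contacts in increasing order. As long as the next
contact is at most `l + Δ + 1`, every window of length `Δ` is hit and the interval goes on. -/
def maxIntervalsFrom {n : ℕ} (Δ : ℕ) (T : NonemptyInterval ℕ) (w : Fin n) (a l : ℕ) :
    List ℕ → Timed (List (VIPair n))
  | [] => do step; pure (consIfLong Δ w a (min T.snd (l + Δ)) [])
  | t :: ts => do
    step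
    if t ≤ l + Δ + 1 then maxIntervalsFrom Δ T w a t ts
    else
      let r ← maxIntervalsFrom Δ T w (max T.fst (t - Δ)) t ts
      pure (consIfLong Δ w a (min T.snd (l + Δ)) r)

/-- All pairs `(w, I)` with `I ⊆ T` a maximal interval of length at least `Δ` all of whose windows
of length `Δ` contain one of the given time stamps (in increasing order). -/
def maxIntervals {n : ℕ} (Δ : ℕ) (T : NonemptyInterval ℕ) (w : Fin n) :
    List ℕ → Timed (List (VIPair n))
  | [] => do step; pure []
  | t :: ts => do
    step
    maxIntervalsFrom Δ T w (max T.fst (t - Δ)) t ts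

/-- Collects the maximal intervals for all the vertices of a list. -/
def collectIntervals {n : ℕ} (Δ : ℕ) (T : NonemptyInterval ℕ) (cs : List (Fin n × ℕ)) :
    List (Fin n) → Timed (List (VIPair n))
  | [] => do step; pure []
  | w :: ws => do
    step
    let ts ← contactTimes w cs
    let a ← maxIntervals Δ T w ts
    let b ← collectIntervals Δ T cs ws
    concat a b

/-- The `Δ`-neighborhood `N(v, T)`, from the time-edges sorted by time stamp and the list of all
vertices: all `(w, I)` such that `I ⊆ T` is a maximal interval of length at least `Δ` all of whose
windows of length `Δ` contain a time-edge between `v` and `w`. -/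
def neighborhood {n : ℕ} (Δ : ℕ) (T : NonemptyInterval ℕ) (es : List (Fin n × Fin n × ℕ))
    (vs : List (Fin n)) (v : Fin n) : Timed (List (VIPair n)) := do
  step
  let cs ← contacts v es
  match cs with
  | [] => pure []
  | _ :: _ => collectIntervals Δ T cs vs

/-! ## The algorithm `BronKerboschDelta` -/

/-- Tests whether `I' ⊊ I` for all pairs `(w, I')` of the list. -/
def allProper {n : ℕ} (I : NonemptyInterval ℕ) : List (VIPair n) → Timed Bool
  | [] => do step; pure true
  | (_, J) :: L => do
    step
    if I.fst ≤ J.fst ∧ J.snd ≤ I.snd ∧ ¬ (J.fst = I.fst ∧ J.snd = I.snd) then allProper I L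
    else pure false

/-- The loop `for (v, I') ∈ P` of `BronKerboschDelta` for `R = (C, I)`; `call` is the recursive call.
`sol` is the solution found so far, and the solution at the end of the loop is returned. `N v` is
`N(v, T)`, from which `M = N(v, I')` is obtained. `P` is kept in increasing and `X` in decreasing
order. -/
def bronKerboschDeltaLoop {n : ℕ} (Δ : ℕ) (N : Fin n → List (VIPair n))
    (call : List (VIPair n) → List (Fin n) × NonemptyInterval ℕ → List (VIPair n) →
      List (List (Fin n) × NonemptyInterval ℕ) → Comp (List (List (Fin n) × NonemptyInterval ℕ)))
    (C : List (Fin n)) :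
    List (VIPair n) → List (VIPair n) → List (List (Fin n) × NonemptyInterval ℕ) →
      Comp (List (List (Fin n) × NonemptyInterval ℕ))
  | [], _, sol => do step; pure sol
  | (v, I') :: P, X, sol => do
    step
    let M ← restrictTo Δ I' (N v)
    let P' ← deltaCut Δ ((v, I') :: P) M
    let X' ← deltaCutDesc Δ X M
    let sol' ← call P' (v :: C, I') X' sol
    let X₁ ← insertDesc (v, I') X
    bronKerboschDeltaLoop Δ N call C P X₁ sol'

/-- `BronKerboschDelta(P, R = (C, I), X)`, where `C` is a list of vertices. The first argument is
the recursion depth that is still available: a computation that would go deeper is not cut off but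
fails as a whole, with result `none`. -/
def bronKerboschDeltaAux {n : ℕ} (Δ : ℕ) (N : Fin n → List (VIPair n)) :
    ℕ → List (VIPair n) → List (Fin n) × NonemptyInterval ℕ → List (VIPair n) →
      List (List (Fin n) × NonemptyInterval ℕ) → Comp (List (List (Fin n) × NonemptyInterval ℕ))
  | 0, _, _, _, _ => failure
  | depth + 1, P, (C, I), X, sol => do
    step
    let p ← allProper I P
    let x ← allProper I X
    if p && x then
      -- add `R` to the solution; writing it down takes time linear in the size of `C`
      let C' ← concat C []
      bronKerboschDeltaLoop Δ N (bronKerboschDeltaAux Δ N depth) C P X ((C', I) :: sol)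
    else
      bronKerboschDeltaLoop Δ N (bronKerboschDeltaAux Δ N depth) C P X sol

/-- The set `{(v, T) | v ∈ V}` as a list. -/
def initialPairs {n : ℕ} (T : NonemptyInterval ℕ) : List (Fin n) → Timed (List (VIPair n))
  | [] => do step; pure []
  | v :: vs => do
    step
    let r ← initialPairs T vs
    pure ((v, T) :: r)

/-- The whole computation on the temporal graph with vertex set `Fin n`, lifetime `T` and the
time-edges listed in `es`: preprocessing, then the initial call with
`P = {(v, T) | v ∈ V}`, `R = (∅, T)` and `X = ∅`. Since every recursive call adds a vertex to `C`, a
recursion depth of `n + 1` has to suffice. -/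
def bronKerboschDeltaComp {n : ℕ} (Δ : ℕ) (T : NonemptyInterval ℕ)
    (es : List (Fin n × Fin n × ℕ)) : Comp (List (List (Fin n) × NonemptyInterval ℕ)) := do
  let es' ← sortByTime es T.fst (T.snd - T.fst + 1)
  let vs ← vertexList n
  let N ← tabulate (neighborhood Δ T es' vs)
  let P ← initialPairs T vs
  bronKerboschDeltaAux Δ N (n + 1) P ([], T) [] []

/-- The solution of `BronKerboschDelta` and the number of steps taken, or `none` if the recursion
goes deeper than `n + 1` levels. -/
def bronKerboschDelta {n : ℕ} (Δ : ℕ) (T : NonemptyInterval ℕ) (es : List (Fin n × Fin n × ℕ)) :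
    Option (List (List (Fin n) × NonemptyInterval ℕ) × ℕ) :=
  (bronKerboschDeltaComp Δ T es).run 0

/-- The input list `es` lists the time-edges of `G`, each of them exactly once, in any order. -/
def TemporalGraph.IsListedBy {n : ℕ} (G : TemporalGraph (Fin n))
    (es : List (Fin n × Fin n × ℕ)) : Prop :=
  (es.map fun e => (s(e.1, e.2.1), e.2.2)).Nodup ∧
    ∀ e : Sym2 (Fin n) × ℕ, e ∈ es.map (fun e => (s(e.1, e.2.1), e.2.2)) ↔ e ∈ G.E

/-- The solution contains every maximal `Δ`-clique of `G` exactly once, and nothing else. -/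
def TemporalGraph.EnumeratesMaximalDeltaCliques {n : ℕ} (G : TemporalGraph (Fin n)) (Δ : ℕ)
    (sol : List (List (Fin n) × NonemptyInterval ℕ)) : Prop :=
  (sol.map fun R => (R.1.toFinset, R.2)).Nodup ∧
    ∀ R : Finset (Fin n) × NonemptyInterval ℕ,
      R ∈ sol.map (fun R => (R.1.toFinset, R.2)) ↔ G.IsMaximalDeltaClique Δ R

/-!
The proof encodes an interval `[a, b]` by the starting points `τ ∈ [a, b - Δ]` of its windows
`[τ, τ + Δ]`. A pair `(C, I)` is then a time-maximal `Δ`-clique if and only if `I` is a maximal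
run (`IsRun`) of windows `τ` such that `C` is a clique of the `Δ`-slice at `τ`. A sorted list of
vertex-interval pairs whose intervals for one vertex are not even adjacent (`WellFormed`) is
determined by the windows it covers (`Covers`), and `deltaCut` and `restrictTo` intersect the
sets of covered windows.

Correctness. In the call for `R = (C, I)`, the pairs of `P` and `X` together cover, for every
vertex, the windows of `I` in which it is adjacent to all of `C`; `P` has the vertices above `C`
and `X` the others (`CallInvariant`). The invariant is passed on to the recursive calls
(`LoopInvariant.callInvariant`). As the vertices of `C` are added in increasing order, every
time-maximal `Δ`-clique is visited exactly once: it is reached through its smallest vertex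
outside `C` (`CallInvariant.enumerates`, `LoopInvariant.enumerates_cons`). Among these, the test
of the algorithm selects those to which no vertex can be added, which are the maximal `Δ`-cliques
(`LoopInvariant.isMaximalDeltaClique_iff`).

Running time. A time-maximal `Δ`-clique with a non-empty vertex set is determined by its starting
point and a non-empty clique of the `Δ`-slice at that point; a graph of degeneracy `d` on `n`
vertices has at most `n * 2 ^ d` of those (`SimpleGraph.card_cliques_le`), so there are at most
`1 + |T| * n * 2 ^ d` calls. Below the root, `P` and `X` have at most `2 * |E|` elements
together, because every maximal interval starts with `I` or at a window that has become good by a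
time-edge at its end (`TemporalGraph.length_le_of_covers`); so a call takes `O(|E|)` steps. At
the root, `P` and `X` have `n` elements, but the cuts take constant time for the vertices without
a neighbor, and at most `2 * |E|` vertices have one. Altogether there are `O(2 ^ d * n * |T| *
|E|)` steps, and the factor `3 ^ (d / 3)` is not needed.
-/

/-! ### Step counts of the basic programs -/

namespace Timed

variable {α β : Type}

@[simp] theorem val_pure (a : α) : (pure a : Timed α).val = a := rfl

@[simp] theorem cost_pure (a : α) : (pure a : Timed α).cost = 0 := rfl

@[simp] theorem val_bind (x : Timed α) (f : α → Timed β) : (x >>= f).val = (f x.val).val := rfl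

@[simp] theorem cost_bind (x : Timed α) (f : α → Timed β) :
    (x >>= f).cost = x.cost + (f x.val).cost := rfl

@[simp] theorem cost_step : step.cost = 1 := rfl

@[simp] theorem val_ite (p : Prop) [Decidable p] (x y : Timed α) :
    (if p then x else y).val = if p then x.val else y.val := by split_ifs <;> rfl

@[simp] theorem cost_ite (p : Prop) [Decidable p] (x y : Timed α) :
    (if p then x else y).cost = if p then x.cost else y.cost := by split_ifs <;> rfl

end Timed

@[simp] theorem concat_val {α : Type} (A B : List α) : (concat A B).val = A ++ B := by
  induction A with
  | nil => simp [concat]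
  | cons a A ih => simp [concat, ih]

@[simp] theorem concat_cost {α : Type} (A B : List α) : (concat A B).cost = A.length + 1 := by
  induction A with
  | nil => simp [concat]
  | cons a A ih => simp [concat, ih]; omega

@[simp] theorem revConcat_val {α : Type} (A B : List α) :
    (revConcat A B).val = A.reverse ++ B := by
  induction A generalizing B with
  | nil => simp [revConcat]
  | cons a A ih => simp [revConcat, ih]

@[simp] theorem revConcat_cost {α : Type} (A B : List α) :
    (revConcat A B).cost = A.length + 1 := by
  induction A generalizing B with
  | nil => simp [revConcat]
  | cons a A ih => simp [revConcat, ih]; omega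

/-! ### Windows, runs and separated lists of vertex-interval pairs -/

/-- The window `[τ, τ + Δ]` lies in the interval `I`. -/
def InWindow (Δ : ℕ) (I : NonemptyInterval ℕ) (τ : ℕ) : Prop := I.fst ≤ τ ∧ τ + Δ ≤ I.snd

/-- `I` is a maximal interval of length at least `Δ` such that `S` holds at the starting point of
each of its windows of length `Δ`. Equivalently, `[I.fst, I.snd - Δ]` is a maximal run of
consecutive elements of `S`, which is how maximality is encoded: `S` fails just before and just
after. -/
structure IsRun (Δ : ℕ) (S : ℕ → Prop) (I : NonemptyInterval ℕ) : Prop where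
  long : I.fst + Δ ≤ I.snd
  holds : ∀ τ, InWindow Δ I τ → S τ
  before : ∀ τ, τ + 1 = I.fst → ¬ S τ
  after : ∀ τ, τ + Δ = I.snd + 1 → ¬ S τ

theorem InWindow.mono {Δ : ℕ} {I J : NonemptyInterval ℕ} {τ : ℕ} (h : InWindow Δ I τ)
    (hIJ : I ≤ J) : InWindow Δ J τ := by
  obtain ⟨h1, h2⟩ : J.fst ≤ I.fst ∧ I.snd ≤ J.snd := hIJ
  exact ⟨h1.trans h.1, h.2.trans h2⟩

theorem le_of_inWindow {Δ : ℕ} {I J : NonemptyInterval ℕ} (hl : J.fst + Δ ≤ J.snd)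
    (h : ∀ τ, InWindow Δ J τ → InWindow Δ I τ) : J ≤ I := by
  have h1 := h J.fst ⟨le_rfl, hl⟩
  have h2 := h (J.snd - Δ) ⟨by omega, by omega⟩
  exact show I.fst ≤ J.fst ∧ J.snd ≤ I.snd from ⟨h1.1, by have := h2.2; omega⟩

namespace IsRun

variable {Δ : ℕ} {S S' : ℕ → Prop} {I J : NonemptyInterval ℕ}

theorem inWindow_fst (h : IsRun Δ S I) : InWindow Δ I I.fst := ⟨le_rfl, h.long⟩

/-- A run contains every interval that meets it in a window and all of whose windows are good. -/
theorem le_of_holds (hJ : IsRun Δ S J) (hI : ∀ τ, InWindow Δ I τ → S τ) {τ : ℕ}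
    (h1 : InWindow Δ I τ) (h2 : InWindow Δ J τ) : I ≤ J := by
  obtain ⟨a1, a2⟩ := h1
  obtain ⟨b1, b2⟩ := h2
  refine show J.fst ≤ I.fst ∧ I.snd ≤ J.snd from ⟨?_, ?_⟩ <;> by_contra! h
  · exact hJ.before (J.fst - 1) (by omega) (hI _ ⟨by omega, by omega⟩)
  · exact hJ.after (J.snd + 1 - Δ) (by omega) (hI _ ⟨by omega, by omega⟩)

theorem eq_of_inWindow (hI : IsRun Δ S I) (hJ : IsRun Δ S J) {τ : ℕ}
    (h1 : InWindow Δ I τ) (h2 : InWindow Δ J τ) : I = J :=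
  le_antisymm (hJ.le_of_holds hI.holds h1 h2) (hI.le_of_holds hJ.holds h2 h1)

theorem congr (h : ∀ τ, S τ ↔ S' τ) (hI : IsRun Δ S I) : IsRun Δ S' I := by
  have : S = S' := funext fun τ => propext (h τ)
  exact this ▸ hI

/-- A run `J` of `S'` inside a run `I` of `S` is a run of `S ∧ S'`. -/
theorem and (hI : IsRun Δ S I) (hJ : IsRun Δ (fun τ => InWindow Δ I τ ∧ S' τ) J) :
    IsRun Δ (fun τ => S τ ∧ S' τ) J := by
  have hle : J ≤ I := le_of_inWindow hJ.long fun τ hτ => (hJ.holds τ hτ).1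
  obtain ⟨h1, h2⟩ : I.fst ≤ J.fst ∧ J.snd ≤ I.snd := id hle
  have hl := hJ.long
  refine ⟨hl, fun τ hτ => ⟨hI.holds τ (hτ.mono hle), (hJ.holds τ hτ).2⟩, ?_, ?_⟩
  · rintro τ hτ ⟨s, s'⟩
    rcases h1.eq_or_lt with h | h
    · exact hI.before τ (by omega) s
    · exact hJ.before τ hτ ⟨⟨by omega, by omega⟩, s'⟩
  · rintro τ hτ ⟨s, s'⟩
    rcases h2.eq_or_lt with h | h
    · exact hI.after τ (by omega) s
    · exact hJ.after τ hτ ⟨⟨by omega, by omega⟩, s'⟩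

end IsRun

section Lists

variable {n : ℕ} {Δ : ℕ}

/-- `p` comes before `q`, and if they have the same vertex, then the starting points of their
windows are not even adjacent. -/
def Separated (Δ : ℕ) (p q : VIPair n) : Prop :=
  p.1 < q.1 ∨ p.1 = q.1 ∧ p.2.snd + 1 < q.2.fst + Δ

/-- A list of vertex-interval pairs is well-formed if its intervals have length at least `Δ` and it
is sorted and separated. Such a list is determined by the windows that it covers. -/
structure WellFormed (Δ : ℕ) (L : List (VIPair n)) : Prop where
  long : ∀ p ∈ L, p.2.fst + Δ ≤ p.2.snd
  separated : L.Pairwise (Separated Δ)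

/-- The list has a pair `(w, J)` such that the window `[τ, τ + Δ]` lies in `J`. -/
def Covers (Δ : ℕ) (L : List (VIPair n)) (w : Fin n) (τ : ℕ) : Prop :=
  ∃ J, (w, J) ∈ L ∧ InWindow Δ J τ

@[simp] theorem covers_nil (w : Fin n) (τ : ℕ) : ¬ Covers Δ [] w τ := by simp [Covers]

theorem covers_cons {p : VIPair n} {L : List (VIPair n)} {w : Fin n} {τ : ℕ} :
    Covers Δ (p :: L) w τ ↔ (w = p.1 ∧ InWindow Δ p.2 τ) ∨ Covers Δ L w τ := by
  obtain ⟨v, I⟩ := p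
  simp only [Covers, List.mem_cons, Prod.mk.injEq, or_and_right, exists_or]
  refine or_congr ⟨?_, ?_⟩ Iff.rfl
  · rintro ⟨J, ⟨rfl, rfl⟩, h⟩; exact ⟨rfl, h⟩
  · rintro ⟨rfl, h⟩; exact ⟨I, ⟨rfl, rfl⟩, h⟩

theorem covers_append {A B : List (VIPair n)} {w : Fin n} {τ : ℕ} :
    Covers Δ (A ++ B) w τ ↔ Covers Δ A w τ ∨ Covers Δ B w τ := by
  simp only [Covers, List.mem_append, or_and_right, exists_or]

theorem wellFormed_nil : WellFormed Δ ([] : List (VIPair n)) := ⟨by simp, List.Pairwise.nil⟩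

theorem wellFormed_cons {p : VIPair n} {L : List (VIPair n)} :
    WellFormed Δ (p :: L) ↔
      p.2.fst + Δ ≤ p.2.snd ∧ (∀ q ∈ L, Separated Δ p q) ∧ WellFormed Δ L := by
  constructor
  · rintro ⟨h1, h2⟩
    rw [List.pairwise_cons] at h2
    exact ⟨h1 p (by simp), h2.1, fun q hq => h1 q (by simp [hq]), h2.2⟩
  · rintro ⟨h1, h2, h3, h4⟩
    exact ⟨by simpa using ⟨h1, fun a b => h3 (a, b)⟩, List.pairwise_cons.2 ⟨h2, h4⟩⟩

theorem wellFormed_append {A B : List (VIPair n)} :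
    WellFormed Δ (A ++ B) ↔
      WellFormed Δ A ∧ WellFormed Δ B ∧ ∀ p ∈ A, ∀ q ∈ B, Separated Δ p q := by
  constructor
  · rintro ⟨h1, h2⟩
    rw [List.pairwise_append] at h2
    exact ⟨⟨fun p hp => h1 p (by simp [hp]), h2.1⟩, ⟨fun p hp => h1 p (by simp [hp]), h2.2.1⟩,
      h2.2.2⟩
  · rintro ⟨⟨h1, h2⟩, ⟨h3, h4⟩, h5⟩
    refine ⟨fun p hp => ?_, List.pairwise_append.2 ⟨h2, h4, h5⟩⟩
    rcases List.mem_append.1 hp with h | h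
    exacts [h1 p h, h3 p h]

theorem WellFormed.nodup {L : List (VIPair n)} (h : WellFormed Δ L) : L.Nodup := by
  refine List.Pairwise.imp_of_mem ?_ h.separated
  rintro p q hp hq hpq rfl
  have := h.long p hp
  rcases hpq with h | h
  · exact lt_irrefl _ h
  · omega

theorem Separated.not_inWindow {v : Fin n} {I J : NonemptyInterval ℕ}
    (h : Separated Δ (v, I) (v, J)) {τ : ℕ} (h1 : InWindow Δ I τ) (h2 : InWindow Δ J τ) :
    False := by
  obtain ⟨a, b⟩ := h1
  obtain ⟨c, d⟩ := h2
  rcases h with h | ⟨-, h⟩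
  · exact lt_irrefl _ h
  · simp only at h; omega

theorem WellFormed.isRun_of_mem {L : List (VIPair n)} (h : WellFormed Δ L) {w : Fin n}
    {J : NonemptyInterval ℕ} (hJ : (w, J) ∈ L) : IsRun Δ (Covers Δ L w) J := by
  have hl : J.fst + Δ ≤ J.snd := h.long _ hJ
  have key : ∀ J', (w, J') ∈ L →
      J' = J ∨ Separated Δ (w, J') (w, J) ∨ Separated Δ (w, J) (w, J') := by
    intro J' hJ'
    by_contra! hne
    have hs : Std.Symm fun p q : VIPair n => Separated Δ p q ∨ Separated Δ q p :=
      ⟨fun _ _ => Or.symm⟩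
    have := (h.separated.imp (S := fun p q => Separated Δ p q ∨ Separated Δ q p)
      Or.inl).forall hJ' hJ (by simpa using hne.1)
    tauto
  refine ⟨hl, fun τ hτ => ⟨J, hJ, hτ⟩, ?_, ?_⟩
  · rintro τ hτ ⟨J', hJ', a, b⟩
    have hl' : J'.fst + Δ ≤ J'.snd := h.long _ hJ'
    rcases key J' hJ' with rfl | (h | ⟨-, h⟩) | (h | ⟨-, h⟩)
    · omega
    · exact lt_irrefl _ h
    · simp only at h; omega
    · exact lt_irrefl _ h
    · simp only at h; omega
  · rintro τ hτ ⟨J', hJ', a, b⟩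
    have hl' : J'.fst + Δ ≤ J'.snd := h.long _ hJ'
    rcases key J' hJ' with rfl | (h | ⟨-, h⟩) | (h | ⟨-, h⟩)
    · omega
    · exact lt_irrefl _ h
    · simp only at h; omega
    · exact lt_irrefl _ h
    · simp only at h; omega

/-- An interval of length at least `Δ` all of whose windows are covered lies in a single interval of
the list. -/
theorem WellFormed.exists_le {L : List (VIPair n)} (h : WellFormed Δ L) {w : Fin n}
    {J : NonemptyInterval ℕ} (hl : J.fst + Δ ≤ J.snd)
    (hJ : ∀ τ, InWindow Δ J τ → Covers Δ L w τ) : ∃ I, (w, I) ∈ L ∧ J ≤ I := by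
  obtain ⟨I, hI, hτ⟩ := hJ J.fst ⟨le_rfl, hl⟩
  exact ⟨I, hI, (h.isRun_of_mem hI).le_of_holds hJ ⟨le_rfl, hl⟩ hτ⟩

/-! ### The list operations of the algorithm -/

theorem mem_consIfLong {v : Fin n} {a b : ℕ} {L : List (VIPair n)} {p : VIPair n} :
    p ∈ consIfLong Δ v a b L ↔
      (p.1 = v ∧ p.2.fst = a ∧ p.2.snd = b ∧ a + Δ ≤ b) ∨ p ∈ L := by
  obtain ⟨w, ⟨x, y⟩, hJ⟩ := p
  unfold consIfLong
  split_ifs with h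
  · simp [h, NonemptyInterval.ext_iff]
  · simp [h]

theorem covers_consIfLong {v : Fin n} {a b : ℕ} {L : List (VIPair n)} {w : Fin n} {τ : ℕ} :
    Covers Δ (consIfLong Δ v a b L) w τ ↔ (w = v ∧ a ≤ τ ∧ τ + Δ ≤ b) ∨ Covers Δ L w τ := by
  unfold consIfLong
  split_ifs with h
  · exact covers_cons
  · constructor
    · exact Or.inr
    · rintro (⟨-, h1, h2⟩ | h1)
      · omega
      · exact h1

theorem wellFormed_consIfLong {v : Fin n} {a b : ℕ} {L : List (VIPair n)} (hL : WellFormed Δ L)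
    (h : ∀ q ∈ L, v < q.1 ∨ v = q.1 ∧ b + 1 < q.2.fst + Δ) :
    WellFormed Δ (consIfLong Δ v a b L) := by
  unfold consIfLong
  split_ifs with hab
  · exact wellFormed_cons.2 ⟨hab, h, hL⟩
  · exact hL

theorem length_consIfLong_le (v : Fin n) (a b : ℕ) (L : List (VIPair n)) :
    (consIfLong Δ v a b L).length ≤ L.length + 1 := by
  unfold consIfLong
  split_ifs <;> simp

theorem deltaCut_nil_left (Y : List (VIPair n)) : deltaCut Δ [] Y = ⟨[], 1⟩ := by
  rw [deltaCut]; rfl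

theorem deltaCut_nil_right (X : List (VIPair n)) : deltaCut Δ X [] = ⟨[], 1⟩ := by
  cases X <;> rw [deltaCut] <;> rfl

theorem deltaCut_val_cons (v w : Fin n) (I J : NonemptyInterval ℕ) (X Y : List (VIPair n)) :
    (deltaCut Δ ((v, I) :: X) ((w, J) :: Y)).val =
      if v < w then (deltaCut Δ X ((w, J) :: Y)).val
      else if w < v then (deltaCut Δ ((v, I) :: X) Y).val
      else consIfLong Δ v (max I.fst J.fst) (min I.snd J.snd)
        (if J.snd < I.snd then (deltaCut Δ ((v, I) :: X) Y).val
          else (deltaCut Δ X ((w, J) :: Y)).val) := by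
  rw [deltaCut]
  split_ifs <;> simp [*]

theorem deltaCut_cost_cons (v w : Fin n) (I J : NonemptyInterval ℕ) (X Y : List (VIPair n)) :
    (deltaCut Δ ((v, I) :: X) ((w, J) :: Y)).cost =
      1 + if v < w then (deltaCut Δ X ((w, J) :: Y)).cost
      else if w < v then (deltaCut Δ ((v, I) :: X) Y).cost
      else if J.snd < I.snd then (deltaCut Δ ((v, I) :: X) Y).cost
      else (deltaCut Δ X ((w, J) :: Y)).cost := by
  rw [deltaCut]; simp

theorem deltaCut_cost_le (X Y : List (VIPair n)) :
    (deltaCut Δ X Y).cost ≤ X.length + Y.length + 1 := by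
  match X, Y with
  | [], Y => simp [deltaCut_nil_left]
  | X, [] => simp [deltaCut_nil_right]
  | (v, I) :: X, (w, J) :: Y =>
    have h1 := deltaCut_cost_le X ((w, J) :: Y)
    have h2 := deltaCut_cost_le ((v, I) :: X) Y
    rw [deltaCut_cost_cons]
    simp only [List.length_cons] at *
    split_ifs <;> omega
termination_by X.length + Y.length

theorem deltaCut_length_le (X Y : List (VIPair n)) :
    (deltaCut Δ X Y).val.length ≤ X.length + Y.length := by
  match X, Y with
  | [], Y => simp [deltaCut_nil_left]
  | X, [] => simp [deltaCut_nil_right]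
  | (v, I) :: X, (w, J) :: Y =>
    have h1 := deltaCut_length_le X ((w, J) :: Y)
    have h2 := deltaCut_length_le ((v, I) :: X) Y
    have h3 := length_consIfLong_le (Δ := Δ) v (max I.fst J.fst) (min I.snd J.snd)
      (deltaCut Δ ((v, I) :: X) Y).val
    have h4 := length_consIfLong_le (Δ := Δ) v (max I.fst J.fst) (min I.snd J.snd)
      (deltaCut Δ X ((w, J) :: Y)).val
    rw [deltaCut_val_cons]
    simp only [List.length_cons] at *
    split_ifs <;> omega
termination_by X.length + Y.length

theorem mem_deltaCut {X Y : List (VIPair n)} {p : VIPair n} (hp : p ∈ (deltaCut Δ X Y).val) :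
    ∃ I J, (p.1, I) ∈ X ∧ (p.1, J) ∈ Y ∧ p.2.fst = max I.fst J.fst ∧ p.2.snd = min I.snd J.snd := by
  match X, Y with
  | [], Y => simp [deltaCut_nil_left] at hp
  | X, [] => simp [deltaCut_nil_right] at hp
  | (v, I) :: X, (w, J) :: Y =>
    have h1 := fun h => mem_deltaCut (X := X) (Y := (w, J) :: Y) (p := p) h
    have h2 := fun h => mem_deltaCut (X := (v, I) :: X) (Y := Y) (p := p) h
    have h1' : p ∈ (deltaCut Δ X ((w, J) :: Y)).val → ∃ I' J', (p.1, I') ∈ (v, I) :: X ∧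
        (p.1, J') ∈ (w, J) :: Y ∧ p.2.fst = max I'.fst J'.fst ∧ p.2.snd = min I'.snd J'.snd := by
      intro h
      obtain ⟨I', J', a, b, c⟩ := h1 h
      exact ⟨I', J', List.mem_cons_of_mem _ a, b, c⟩
    have h2' : p ∈ (deltaCut Δ ((v, I) :: X) Y).val → ∃ I' J', (p.1, I') ∈ (v, I) :: X ∧
        (p.1, J') ∈ (w, J) :: Y ∧ p.2.fst = max I'.fst J'.fst ∧ p.2.snd = min I'.snd J'.snd := by
      intro h
      obtain ⟨I', J', a, b, c⟩ := h2 h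
      exact ⟨I', J', a, List.mem_cons_of_mem _ b, c⟩
    rw [deltaCut_val_cons] at hp
    split_ifs at hp with hvw hwv hsnd
    · exact h1' hp
    · exact h2' hp
    · rcases mem_consIfLong.1 hp with ⟨a, b, c, -⟩ | hp
      · exact ⟨I, J, by simp [a], by simp [a, le_antisymm (not_lt.1 hwv) (not_lt.1 hvw)], b, c⟩
      · exact h2' hp
    · rcases mem_consIfLong.1 hp with ⟨a, b, c, -⟩ | hp
      · exact ⟨I, J, by simp [a], by simp [a, le_antisymm (not_lt.1 hwv) (not_lt.1 hvw)], b, c⟩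
      · exact h1' hp
termination_by X.length + Y.length

theorem WellFormed.deltaCut {X Y : List (VIPair n)} (hX : WellFormed Δ X) (hY : WellFormed Δ Y) :
    WellFormed Δ (deltaCut Δ X Y).val := by
  match X, Y with
  | [], Y => simpa [deltaCut_nil_left] using wellFormed_nil
  | X, [] => simpa [deltaCut_nil_right] using wellFormed_nil
  | (v, I) :: X, (w, J) :: Y =>
    obtain ⟨-, hX1, hX2⟩ := wellFormed_cons.1 hX
    obtain ⟨-, hY1, hY2⟩ := wellFormed_cons.1 hY
    have h1 := hX2.deltaCut hY
    have h2 := hX.deltaCut hY2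
    rw [deltaCut_val_cons]
    split_ifs with hvw hwv hsnd
    · exact h1
    · exact h2
    · refine wellFormed_consIfLong h2 fun q hq => ?_
      obtain ⟨I', J', a, b, c, d⟩ := mem_deltaCut hq
      obtain rfl := le_antisymm (not_lt.1 hwv) (not_lt.1 hvw)
      refine (hY1 _ b).imp id (And.imp_right fun h => ?_)
      simp only at h
      omega
    · refine wellFormed_consIfLong h1 fun q hq => ?_
      obtain ⟨I', J', a, b, c, d⟩ := mem_deltaCut hq
      refine (hX1 _ a).imp id (And.imp_right fun h => ?_)
      simp only at h
      omega
termination_by X.length + Y.length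

/-- Merging never skips a common window: the interval that is dropped is the one that ends first, so
it does not meet the later intervals of the other list. -/
theorem covers_deltaCut {X Y : List (VIPair n)} (hX : WellFormed Δ X) (hY : WellFormed Δ Y)
    {u : Fin n} {τ : ℕ} :
    Covers Δ (deltaCut Δ X Y).val u τ ↔ Covers Δ X u τ ∧ Covers Δ Y u τ := by
  match X, Y with
  | [], Y => simp [deltaCut_nil_left]
  | X, [] => simp [deltaCut_nil_right]
  | (v, I) :: X, (w, J) :: Y =>
    obtain ⟨-, hX1, hX2⟩ := wellFormed_cons.1 hX
    obtain ⟨-, hY1, hY2⟩ := wellFormed_cons.1 hY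
    have h1 := covers_deltaCut hX2 hY (u := u) (τ := τ)
    have h2 := covers_deltaCut hX hY2 (u := u) (τ := τ)
    rw [deltaCut_val_cons]
    split_ifs with hvw hwv hsnd
    · rw [h1, covers_cons (L := X)]
      refine and_congr_left fun hc => (or_iff_right ?_).symm
      rintro ⟨rfl, -⟩
      obtain ⟨J', hJ', -⟩ := hc
      rcases List.mem_cons.1 hJ' with h | h
      · obtain ⟨rfl, -⟩ := Prod.mk.inj h
        exact lt_irrefl _ hvw
      · rcases hY1 _ h with h | h
        · exact lt_asymm hvw h
        · exact hvw.ne' h.1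
    · rw [h2, covers_cons (L := Y)]
      refine and_congr_right fun hc => (or_iff_right ?_).symm
      rintro ⟨rfl, -⟩
      obtain ⟨J', hJ', -⟩ := hc
      rcases List.mem_cons.1 hJ' with h | h
      · obtain ⟨rfl, -⟩ := Prod.mk.inj h
        exact lt_irrefl _ hwv
      · rcases hX1 _ h with h | h
        · exact lt_asymm hwv h
        · exact hwv.ne' h.1
    · obtain rfl := le_antisymm (not_lt.1 hwv) (not_lt.1 hvw)
      rw [covers_consIfLong, h2]
      constructor
      · rintro (⟨rfl, a, b⟩ | ⟨a, b⟩)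
        · exact ⟨covers_cons.2 (Or.inl ⟨rfl, by simp only; omega, by simp only; omega⟩),
            covers_cons.2 (Or.inl ⟨rfl, by simp only; omega, by simp only; omega⟩)⟩
        · exact ⟨a, covers_cons.2 (Or.inr b)⟩
      · rintro ⟨a, b⟩
        rcases covers_cons.1 b with ⟨rfl, c, d⟩ | b
        · rcases covers_cons.1 a with ⟨-, c', d'⟩ | ⟨I', hI', a1, a2⟩
          · exact Or.inl ⟨rfl, by simp only at *; omega, by simp only at *; omega⟩
          · rcases hX1 _ hI' with h | ⟨-, h⟩
            · exact absurd h (lt_irrefl _)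
            · simp only at *; omega
        · exact Or.inr ⟨a, b⟩
    · obtain rfl := le_antisymm (not_lt.1 hwv) (not_lt.1 hvw)
      rw [covers_consIfLong, h1]
      constructor
      · rintro (⟨rfl, a, b⟩ | ⟨a, b⟩)
        · exact ⟨covers_cons.2 (Or.inl ⟨rfl, by simp only; omega, by simp only; omega⟩),
            covers_cons.2 (Or.inl ⟨rfl, by simp only; omega, by simp only; omega⟩)⟩
        · exact ⟨covers_cons.2 (Or.inr a), b⟩
      · rintro ⟨a, b⟩
        rcases covers_cons.1 a with ⟨rfl, c, d⟩ | a
        · rcases covers_cons.1 b with ⟨-, c', d'⟩ | ⟨J', hJ', a1, a2⟩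
          · exact Or.inl ⟨rfl, by simp only at *; omega, by simp only at *; omega⟩
          · rcases hY1 _ hJ' with h | ⟨-, h⟩
            · exact absurd h (lt_irrefl _)
            · simp only at *; omega
        · exact Or.inr ⟨a, b⟩
termination_by X.length + Y.length

@[simp] theorem restrictTo_cost (I : NonemptyInterval ℕ) (L : List (VIPair n)) :
    (restrictTo Δ I L).cost = L.length + 1 := by
  induction L with
  | nil => simp [restrictTo]
  | cons p L ih => simp [restrictTo, ih]; omega

theorem restrictTo_length_le (I : NonemptyInterval ℕ) (L : List (VIPair n)) :
    (restrictTo Δ I L).val.length ≤ L.length := by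
  induction L with
  | nil => simp [restrictTo]
  | cons p L ih =>
    simp only [restrictTo, Timed.val_bind, Timed.val_pure, List.length_cons]
    exact (length_consIfLong_le _ _ _ _).trans (by omega)

theorem mem_restrictTo {I : NonemptyInterval ℕ} {L : List (VIPair n)} {p : VIPair n}
    (hp : p ∈ (restrictTo Δ I L).val) :
    ∃ J, (p.1, J) ∈ L ∧ p.2.fst = max I.fst J.fst ∧ p.2.snd = min I.snd J.snd := by
  induction L with
  | nil => simp [restrictTo] at hp
  | cons q L ih =>
    simp only [restrictTo, Timed.val_bind, Timed.val_pure] at hp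
    rcases mem_consIfLong.1 hp with ⟨a, b, c, -⟩ | hp
    · exact ⟨q.2, by simp [a], b, c⟩
    · obtain ⟨J, a, b⟩ := ih hp
      exact ⟨J, List.mem_cons_of_mem _ a, b⟩

theorem WellFormed.restrictTo {L : List (VIPair n)} (hL : WellFormed Δ L)
    (I : NonemptyInterval ℕ) : WellFormed Δ (restrictTo Δ I L).val := by
  induction L with
  | nil => simpa [_root_.restrictTo] using wellFormed_nil
  | cons p L ih =>
    obtain ⟨-, h1, h2⟩ := wellFormed_cons.1 hL
    simp only [_root_.restrictTo, Timed.val_bind, Timed.val_pure]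
    refine wellFormed_consIfLong (ih h2) fun q hq => ?_
    obtain ⟨J, a, b, c⟩ := mem_restrictTo hq
    refine (h1 _ a).imp id (And.imp_right fun h => ?_)
    simp only at h
    omega

theorem covers_restrictTo {I : NonemptyInterval ℕ} {L : List (VIPair n)} {w : Fin n} {τ : ℕ} :
    Covers Δ (restrictTo Δ I L).val w τ ↔ InWindow Δ I τ ∧ Covers Δ L w τ := by
  induction L with
  | nil => simp [restrictTo]
  | cons p L ih =>
    simp only [restrictTo, Timed.val_bind, Timed.val_pure, covers_consIfLong, ih, covers_cons,
      InWindow, max_le_iff, le_min_iff]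
    tauto

@[simp] theorem deltaCutDesc_val (X Y : List (VIPair n)) :
    (deltaCutDesc Δ X Y).val = (deltaCut Δ X.reverse Y).val.reverse := by
  cases Y with
  | nil => simp [deltaCutDesc, deltaCut_nil_right]
  | cons p Y => simp [deltaCutDesc]

/-- A pair that comes after all pairs of `X` is inserted in one step. -/
theorem insertDesc_eq_cons {X : List (VIPair n)} {p : VIPair n}
    (h : ∀ q ∈ X, Separated Δ q p) (hX : ∀ q ∈ X, q.2.fst + Δ ≤ q.2.snd) :
    insertDesc p X = ⟨p :: X, 1⟩ := by
  cases X with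
  | nil => rfl
  | cons q X =>
    have h1 := h q (by simp)
    have h2 := hX q (by simp)
    have : ¬ (p.1 < q.1 ∨ (p.1 = q.1 ∧ p.2.fst < q.2.fst)) := by
      rintro (h3 | ⟨h3, h4⟩) <;> rcases h1 with h1 | ⟨h1, h5⟩
      · exact lt_asymm h1 h3
      · exact h3.ne' h1
      · exact h1.ne' h3
      · omega
    rw [insertDesc, if_neg this]
    rfl

/-- A bound for the cost of one round of the loop of `BronKerboschDelta`, apart from the recursive
call, if `N` is the `Δ`-neighborhood `N(v, T)` and `ℓ` the total length of the lists `P` and `X`. It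
does not depend on `ℓ` if the neighborhood is empty; at the root, where `ℓ` is the number of all
vertices, this matters. -/
def roundCost (N : List (VIPair n)) (ℓ : ℕ) : ℕ :=
  8 + 4 * N.length + if N = [] then 0 else 3 * ℓ

theorem round_cost_le (I : NonemptyInterval ℕ) (N P X : List (VIPair n)) :
    1 + (restrictTo Δ I N).cost + (deltaCut Δ P (restrictTo Δ I N).val).cost +
      (deltaCutDesc Δ X (restrictTo Δ I N).val).cost + 1 ≤ roundCost N (X.length + P.length) := by
  have hM := restrictTo_length_le (Δ := Δ) I N
  have h1 := deltaCut_cost_le (Δ := Δ) P (restrictTo Δ I N).val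
  rw [restrictTo_cost]
  generalize (restrictTo Δ I N).val = M at *
  unfold roundCost
  cases M with
  | nil => simp [deltaCut_nil_right, deltaCutDesc]; omega
  | cons p M =>
    have h2 := deltaCut_cost_le (Δ := Δ) X.reverse (p :: M)
    have h3 := deltaCut_length_le (Δ := Δ) X.reverse (p :: M)
    have hN : N ≠ [] := by rintro rfl; simp at hM
    simp only [deltaCutDesc, Timed.cost_bind, Timed.cost_step, revConcat_cost, revConcat_val,
      List.append_nil, hN, if_false]
    simp only [List.length_reverse] at *
    omega

/-- For intervals inside `I`, the test fails exactly if one of them is `I`. -/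
theorem allProper_val {I : NonemptyInterval ℕ} {L : List (VIPair n)} (h : ∀ p ∈ L, p.2 ≤ I) :
    (allProper I L).val = true ↔ ∀ p ∈ L, p.2 ≠ I := by
  induction L with
  | nil => simp [allProper]
  | cons p L ih =>
    have hp : I.fst ≤ p.2.fst ∧ p.2.snd ≤ I.snd := h p (by simp)
    have := ih fun q hq => h q (by simp [hq])
    have heq : p.2 = I ↔ p.2.fst = I.fst ∧ p.2.snd = I.snd := by
      rw [NonemptyInterval.ext_iff, Prod.ext_iff]
    simp only [allProper, Timed.val_bind, Timed.val_ite, Timed.val_pure, List.forall_mem_cons,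
      ne_eq, heq]
    split_ifs with hc
    · rw [this]; tauto
    · constructor
      · intro h; cases h
      · tauto

theorem allProper_cost_le (I : NonemptyInterval ℕ) (L : List (VIPair n)) :
    (allProper I L).cost ≤ L.length + 1 := by
  induction L with
  | nil => simp [allProper]
  | cons p L ih =>
    simp only [allProper, Timed.cost_bind, Timed.cost_step, Timed.cost_ite, Timed.cost_pure,
      List.length_cons]
    split_ifs <;> omega

@[simp] theorem initialPairs_val (T : NonemptyInterval ℕ) (vs : List (Fin n)) :
    (initialPairs T vs).val = vs.map fun v => (v, T) := by
  induction vs with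
  | nil => simp [initialPairs]
  | cons v vs ih => simp [initialPairs, ih]

@[simp] theorem initialPairs_cost (T : NonemptyInterval ℕ) (vs : List (Fin n)) :
    (initialPairs T vs).cost = vs.length + 1 := by
  induction vs with
  | nil => simp [initialPairs]
  | cons v vs ih => simp [initialPairs, ih]; omega

end Lists

/-! ### Preprocessing -/

section Preprocessing

variable {n : ℕ} {Δ : ℕ}

@[simp] theorem edgesAt_val (t : ℕ) (es : List (Fin n × Fin n × ℕ)) :
    (edgesAt t es).val = es.filter fun e => e.2.2 = t := by
  induction es with
  | nil => simp [edgesAt]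
  | cons e es ih => by_cases h : e.2.2 = t <;> simp [edgesAt, ih, h]

@[simp] theorem edgesAt_cost (t : ℕ) (es : List (Fin n × Fin n × ℕ)) :
    (edgesAt t es).cost = es.length + 1 := by
  induction es with
  | nil => simp [edgesAt]
  | cons e es ih => simp [edgesAt, ih]; omega

theorem sortByTime_zero (es : List (Fin n × Fin n × ℕ)) (t : ℕ) :
    sortByTime es t 0 = ⟨[], 1⟩ := rfl

theorem sortByTime_succ_val (es : List (Fin n × Fin n × ℕ)) (t k : ℕ) :
    (sortByTime es t (k + 1)).val =
      (es.filter fun e => e.2.2 = t) ++ (sortByTime es (t + 1) k).val := by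
  simp [sortByTime]

theorem mem_sortByTime {es : List (Fin n × Fin n × ℕ)} {t k : ℕ} {e : Fin n × Fin n × ℕ} :
    e ∈ (sortByTime es t k).val ↔ e ∈ es ∧ t ≤ e.2.2 ∧ e.2.2 < t + k := by
  induction k generalizing t with
  | zero => simp [sortByTime_zero]
  | succ k ih =>
    rw [sortByTime_succ_val, List.mem_append, ih, List.mem_filter, decide_eq_true_iff,
      ← and_or_left]
    refine and_congr_right fun _ => ?_
    omega

theorem pairwise_sortByTime (es : List (Fin n × Fin n × ℕ)) (t k : ℕ) :
    (sortByTime es t k).val.Pairwise fun e e' => e.2.2 ≤ e'.2.2 := by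
  induction k generalizing t with
  | zero => simp [sortByTime_zero]
  | succ k ih =>
    rw [sortByTime_succ_val, List.pairwise_append]
    refine ⟨List.Pairwise.imp_of_mem (R := fun _ _ => True) ?_
      (List.pairwise_of_forall fun _ _ => trivial), ih _, ?_⟩
    · intro a b ha hb _
      simp only [List.mem_filter, decide_eq_true_iff] at ha hb
      omega
    · intro a ha b hb
      have := mem_sortByTime.1 hb
      simp only [List.mem_filter, decide_eq_true_iff] at ha
      omega

theorem sortByTime_length_le (es : List (Fin n × Fin n × ℕ)) (t k : ℕ) :
    (sortByTime es t k).val.length ≤ es.length := by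
  suffices h : (sortByTime es t k).val.length =
      es.countP fun e => t ≤ e.2.2 ∧ e.2.2 < t + k from h ▸ List.countP_le_length
  induction k generalizing t with
  | zero =>
    rw [sortByTime_zero, eq_comm, List.length_nil, List.countP_eq_zero]
    simp
  | succ k ih =>
    rw [sortByTime_succ_val, List.length_append, ih, ← List.countP_eq_length_filter]
    clear ih
    induction es with
    | nil => simp
    | cons e es ih =>
      simp only [List.countP_cons, decide_eq_true_iff] at ih ⊢
      split_ifs <;> omega

theorem sortByTime_cost_le (es : List (Fin n × Fin n × ℕ)) (t k : ℕ) :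
    (sortByTime es t k).cost ≤ k * (2 * es.length + 3) + 1 := by
  induction k generalizing t with
  | zero => simp [sortByTime_zero]
  | succ k ih =>
    have := ih (t + 1)
    have h := List.length_filter_le (fun e : Fin n × Fin n × ℕ => decide (e.2.2 = t)) es
    simp only [sortByTime, Timed.cost_bind, Timed.cost_step, edgesAt_cost, edgesAt_val,
      concat_cost]
    rw [add_mul]
    omega

@[simp] theorem contacts_cost (v : Fin n) (es : List (Fin n × Fin n × ℕ)) :
    (contacts v es).cost = es.length + 1 := by
  induction es with
  | nil => simp [contacts]
  | cons e es ih => simp [contacts, ih]; omega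

@[simp] theorem contactTimes_cost (w : Fin n) (cs : List (Fin n × ℕ)) :
    (contactTimes w cs).cost = cs.length + 1 := by
  induction cs with
  | nil => simp [contactTimes]
  | cons e es ih => simp [contactTimes, ih]; omega

theorem contacts_cons_val (v x y : Fin n) (t : ℕ) (es : List (Fin n × Fin n × ℕ)) :
    (contacts v ((x, y, t) :: es)).val =
      if x = v then (y, t) :: (contacts v es).val
      else if y = v then (x, t) :: (contacts v es).val else (contacts v es).val := by
  simp [contacts]

theorem contactTimes_cons_val (w : Fin n) (c : Fin n × ℕ) (cs : List (Fin n × ℕ)) :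
    (contactTimes w (c :: cs)).val =
      if c.1 = w then c.2 :: (contactTimes w cs).val else (contactTimes w cs).val := by
  simp [contactTimes]

theorem contacts_sublist (v : Fin n) (es : List (Fin n × Fin n × ℕ)) :
    ((contacts v es).val.map fun c => c.2).Sublist (es.map fun e => e.2.2) := by
  induction es with
  | nil => simp [contacts]
  | cons e es ih =>
    obtain ⟨x, y, t⟩ := e
    rw [contacts_cons_val]
    split_ifs
    · simpa using ih
    · simpa using ih
    · exact ih.cons _

theorem contactTimes_sublist (w : Fin n) (cs : List (Fin n × ℕ)) :
    (contactTimes w cs).val.Sublist (cs.map fun c => c.2) := by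
  induction cs with
  | nil => simp [contactTimes]
  | cons c cs ih =>
    rw [contactTimes_cons_val]
    split_ifs
    · simpa using ih
    · exact ih.cons _

theorem contactTimes_length_le (w : Fin n) (cs : List (Fin n × ℕ)) :
    (contactTimes w cs).val.length ≤ cs.length := by
  simpa using (contactTimes_sublist w cs).length_le

theorem mem_contactTimes_contacts {v w : Fin n} {t : ℕ} {es : List (Fin n × Fin n × ℕ)} :
    t ∈ (contactTimes w (contacts v es).val).val ↔
      (s(v, w), t) ∈ es.map fun e => (s(e.1, e.2.1), e.2.2) := by
  induction es with
  | nil => simp [contacts, contactTimes]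
  | cons e es ih =>
    obtain ⟨x, y, t'⟩ := e
    rw [contacts_cons_val, List.map_cons, List.mem_cons, ← ih]
    simp only [Prod.mk.injEq, Sym2.eq_iff]
    split_ifs with h1 h2
    · subst h1
      rw [contactTimes_cons_val]
      split_ifs with h3
      · simp only at h3; subst h3; simp
      · simp only at h3
        constructor
        · exact Or.inr
        · rintro (⟨⟨-, rfl⟩ | ⟨rfl, rfl⟩, -⟩ | h)
          exacts [absurd rfl h3, absurd rfl h3, h]
    · subst h2
      rw [contactTimes_cons_val]
      split_ifs with h3
      · simp only at h3; subst h3; simp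
      · simp only at h3
        constructor
        · exact Or.inr
        · rintro (⟨⟨rfl, rfl⟩ | ⟨-, rfl⟩, -⟩ | h)
          exacts [absurd rfl h3, absurd rfl h3, h]
    · constructor
      · exact Or.inr
      · rintro (⟨⟨rfl, -⟩ | ⟨rfl, -⟩, -⟩ | h)
        exacts [absurd rfl h1, absurd rfl h2, h]

theorem sum_contacts_length_le (es : List (Fin n × Fin n × ℕ)) :
    ∑ v, (contacts v es).val.length ≤ 2 * es.length := by
  induction es with
  | nil => simp [contacts]
  | cons e es ih =>
    obtain ⟨x, y, t⟩ := e
    calc ∑ v, (contacts v ((x, y, t) :: es)).val.length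
        ≤ ∑ v, ((contacts v es).val.length + ((if x = v then 1 else 0) +
            if y = v then 1 else 0)) := by
          refine Finset.sum_le_sum fun v _ => ?_
          rw [contacts_cons_val]
          split_ifs <;> simp
      _ ≤ 2 * ((x, y, t) :: es).length := by
          rw [Finset.sum_add_distrib, Finset.sum_add_distrib]
          simp
          omega

theorem mem_maxIntervalsFrom {T : NonemptyInterval ℕ} {w : Fin n} {a l : ℕ} {ts : List ℕ}
    (hT : T.fst ≤ a) (hal : a ≤ l) (hl : ∀ t ∈ ts, l ≤ t) (hs : ts.Pairwise (· ≤ ·))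
    {p : VIPair n} (hp : p ∈ (maxIntervalsFrom Δ T w a l ts).val) : p.1 = w ∧ a ≤ p.2.fst := by
  induction ts generalizing a l with
  | nil =>
    simp only [maxIntervalsFrom, Timed.val_bind, Timed.val_pure, mem_consIfLong] at hp
    rcases hp with ⟨h1, h2, -⟩ | h
    · exact ⟨h1, h2.ge⟩
    · simp at h
  | cons t ts ih =>
    rw [List.pairwise_cons] at hs
    have hlt := hl t (by simp)
    simp only [maxIntervalsFrom, Timed.val_bind, Timed.val_pure, Timed.val_ite] at hp
    split_ifs at hp with h
    · exact ih hT (hal.trans hlt) hs.1 hs.2 hp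
    · rcases mem_consIfLong.1 hp with ⟨h1, h2, -⟩ | hp
      · exact ⟨h1, h2.ge⟩
      · have := ih (le_max_left _ _) (by omega) hs.1 hs.2 hp
        omega

theorem wellFormed_maxIntervalsFrom {T : NonemptyInterval ℕ} {w : Fin n} {a l : ℕ} {ts : List ℕ}
    (hT : T.fst ≤ a) (hal : a ≤ l) (hl : ∀ t ∈ ts, l ≤ t) (hs : ts.Pairwise (· ≤ ·)) :
    WellFormed Δ (maxIntervalsFrom Δ T w a l ts).val := by
  induction ts generalizing a l with
  | nil =>
    simp only [maxIntervalsFrom, Timed.val_bind, Timed.val_pure]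
    exact wellFormed_consIfLong wellFormed_nil (by simp)
  | cons t ts ih =>
    rw [List.pairwise_cons] at hs
    have hlt := hl t (by simp)
    simp only [maxIntervalsFrom, Timed.val_bind, Timed.val_pure, Timed.val_ite]
    split_ifs with h
    · exact ih hT (hal.trans hlt) hs.1 hs.2
    · have hmax : max T.fst (t - Δ) ≤ t := by omega
      refine wellFormed_consIfLong (ih (le_max_left _ _) hmax hs.1 hs.2) fun q hq => Or.inr ?_
      obtain ⟨h1, h2⟩ := mem_maxIntervalsFrom (le_max_left _ _) hmax hs.1 hs.2 hq
      exact ⟨h1.symm, by omega⟩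

theorem covers_maxIntervalsFrom {T : NonemptyInterval ℕ} {w u : Fin n} {a l τ : ℕ} {ts : List ℕ}
    (hT : T.fst ≤ a) (hal : a ≤ l) (hl : ∀ t ∈ ts, l ≤ t) (hs : ts.Pairwise (· ≤ ·)) :
    Covers Δ (maxIntervalsFrom Δ T w a l ts).val u τ ↔
      u = w ∧ a ≤ τ ∧ τ + Δ ≤ T.snd ∧ (τ ≤ l ∨ ∃ t ∈ ts, τ ≤ t ∧ t ≤ τ + Δ) := by
  induction ts generalizing a l with
  | nil =>
    simp only [maxIntervalsFrom, Timed.val_bind, Timed.val_pure, covers_consIfLong, covers_nil,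
      or_false, List.not_mem_nil, false_and, exists_false]
    refine and_congr_right fun _ => and_congr_right fun _ => ?_
    omega
  | cons t ts ih =>
    rw [List.pairwise_cons] at hs
    have hlt := hl t (by simp)
    simp only [maxIntervalsFrom, Timed.val_bind, Timed.val_pure, Timed.val_ite]
    split_ifs with h
    · rw [ih hT (hal.trans hlt) hs.1 hs.2]
      refine and_congr_right fun _ => and_congr_right fun _ => and_congr_right fun _ => ?_
      rw [List.exists_mem_cons_iff, ← or_assoc]
      exact or_congr_left (by omega)
    · rw [covers_consIfLong, ih (le_max_left _ _) (by omega) hs.1 hs.2, ← and_or_left]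
      refine and_congr_right fun _ => ?_
      rw [List.exists_mem_cons_iff]
      constructor
      · rintro (h1 | ⟨h1, h2, h3⟩)
        · exact ⟨h1.1, by omega, Or.inl (by omega)⟩
        · refine ⟨by omega, h2, Or.inr (h3.imp (fun h4 => ?_) id)⟩
          omega
      · rintro ⟨h1, h2, h3 | h3 | ⟨t', ht', h3⟩⟩
        · exact Or.inl (by omega)
        · exact Or.inr ⟨by omega, h2, Or.inl h3.1⟩
        · have := hs.1 t' ht'
          exact Or.inr ⟨by omega, h2, Or.inr ⟨t', ht', h3⟩⟩

theorem mem_maxIntervals {T : NonemptyInterval ℕ} {w : Fin n} {ts : List ℕ}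
    (hT : ∀ t ∈ ts, T.fst ≤ t) (hs : ts.Pairwise (· ≤ ·)) {p : VIPair n}
    (hp : p ∈ (maxIntervals Δ T w ts).val) : p.1 = w := by
  cases ts with
  | nil => simp [maxIntervals] at hp
  | cons t ts =>
    rw [List.pairwise_cons] at hs
    have := hT t (by simp)
    exact (mem_maxIntervalsFrom (le_max_left _ _) (by omega) hs.1 hs.2 hp).1

theorem wellFormed_maxIntervals {T : NonemptyInterval ℕ} {w : Fin n} {ts : List ℕ}
    (hT : ∀ t ∈ ts, T.fst ≤ t) (hs : ts.Pairwise (· ≤ ·)) :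
    WellFormed Δ (maxIntervals Δ T w ts).val := by
  cases ts with
  | nil => exact wellFormed_nil
  | cons t ts =>
    rw [List.pairwise_cons] at hs
    have := hT t (by simp)
    exact wellFormed_maxIntervalsFrom (le_max_left _ _) (by omega) hs.1 hs.2

theorem covers_maxIntervals {T : NonemptyInterval ℕ} {w u : Fin n} {τ : ℕ} {ts : List ℕ}
    (hT : ∀ t ∈ ts, T.fst ≤ t) (hs : ts.Pairwise (· ≤ ·)) :
    Covers Δ (maxIntervals Δ T w ts).val u τ ↔
      u = w ∧ InWindow Δ T τ ∧ ∃ t ∈ ts, τ ≤ t ∧ t ≤ τ + Δ := by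
  cases ts with
  | nil => simp [maxIntervals]
  | cons t ts =>
    rw [List.pairwise_cons] at hs
    have := hT t (by simp)
    refine (covers_maxIntervalsFrom (le_max_left _ _) (by omega) hs.1 hs.2).trans ?_
    refine and_congr_right fun _ => ?_
    rw [List.exists_mem_cons_iff, InWindow]
    constructor
    · rintro ⟨h1, h2, h3⟩
      refine ⟨⟨by omega, h2⟩, h3.imp (fun h4 => ?_) id⟩
      omega
    · rintro ⟨⟨h1, h2⟩, h3 | ⟨t', ht', h3⟩⟩
      · exact ⟨by omega, h2, Or.inl h3.1⟩
      · have := hs.1 t' ht'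
        exact ⟨by omega, h2, Or.inr ⟨t', ht', h3⟩⟩

theorem maxIntervalsFrom_cost (T : NonemptyInterval ℕ) (w : Fin n) (a l : ℕ) (ts : List ℕ) :
    (maxIntervalsFrom Δ T w a l ts).cost = ts.length + 1 := by
  induction ts generalizing a l with
  | nil => simp [maxIntervalsFrom]
  | cons t ts ih => simp [maxIntervalsFrom, ih]; omega

theorem maxIntervalsFrom_length_le (T : NonemptyInterval ℕ) (w : Fin n) (a l : ℕ)
    (ts : List ℕ) : (maxIntervalsFrom Δ T w a l ts).val.length ≤ ts.length + 1 := by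
  induction ts generalizing a l with
  | nil => exact length_consIfLong_le _ _ _ _
  | cons t ts ih =>
    simp only [maxIntervalsFrom, Timed.val_bind, Timed.val_pure, Timed.val_ite, List.length_cons]
    split_ifs
    · exact (ih _ _).trans (by omega)
    · exact (length_consIfLong_le _ _ _ _).trans (Nat.succ_le_succ (ih _ _))

theorem maxIntervals_cost_le (T : NonemptyInterval ℕ) (w : Fin n) (ts : List ℕ) :
    (maxIntervals Δ T w ts).cost ≤ ts.length + 1 := by
  cases ts with
  | nil => simp [maxIntervals]
  | cons t ts => simp [maxIntervals, maxIntervalsFrom_cost]; omega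

theorem maxIntervals_length_le (T : NonemptyInterval ℕ) (w : Fin n) (ts : List ℕ) :
    (maxIntervals Δ T w ts).val.length ≤ ts.length := by
  cases ts with
  | nil => simp [maxIntervals]
  | cons t ts => exact maxIntervalsFrom_length_le _ _ _ _ _

theorem collectIntervals_cons_val (T : NonemptyInterval ℕ) (cs : List (Fin n × ℕ)) (w : Fin n)
    (ws : List (Fin n)) :
    (collectIntervals Δ T cs (w :: ws)).val =
      (maxIntervals Δ T w (contactTimes w cs).val).val ++ (collectIntervals Δ T cs ws).val := by
  simp [collectIntervals]

theorem mem_contactTimes_le {T : NonemptyInterval ℕ} {cs : List (Fin n × ℕ)}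
    (hT : ∀ c ∈ cs, T.fst ≤ c.2) (w : Fin n) : ∀ t ∈ (contactTimes w cs).val, T.fst ≤ t := by
  intro t ht
  obtain ⟨c, hc, rfl⟩ := List.mem_map.1 ((contactTimes_sublist w cs).subset ht)
  exact hT c hc

theorem pairwise_contactTimes {cs : List (Fin n × ℕ)} (hs : (cs.map fun c => c.2).Pairwise (· ≤ ·))
    (w : Fin n) : (contactTimes w cs).val.Pairwise (· ≤ ·) :=
  hs.sublist (contactTimes_sublist w cs)

theorem mem_collectIntervals {T : NonemptyInterval ℕ} {cs : List (Fin n × ℕ)}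
    (hT : ∀ c ∈ cs, T.fst ≤ c.2) (hs : (cs.map fun c => c.2).Pairwise (· ≤ ·))
    {ws : List (Fin n)} {p : VIPair n} (hp : p ∈ (collectIntervals Δ T cs ws).val) :
    p.1 ∈ ws := by
  induction ws with
  | nil => simp [collectIntervals] at hp
  | cons w ws ih =>
    rw [collectIntervals_cons_val] at hp
    rcases List.mem_append.1 hp with h | h
    · simp [mem_maxIntervals (mem_contactTimes_le hT w) (pairwise_contactTimes hs w) h]
    · exact List.mem_cons_of_mem _ (ih h)

theorem wellFormed_collectIntervals {T : NonemptyInterval ℕ} {cs : List (Fin n × ℕ)}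
    (hT : ∀ c ∈ cs, T.fst ≤ c.2) (hs : (cs.map fun c => c.2).Pairwise (· ≤ ·))
    {ws : List (Fin n)} (hws : ws.Pairwise (· < ·)) :
    WellFormed Δ (collectIntervals Δ T cs ws).val := by
  induction ws with
  | nil => exact wellFormed_nil
  | cons w ws ih =>
    rw [List.pairwise_cons] at hws
    have h1 := mem_contactTimes_le hT w
    have h2 := pairwise_contactTimes hs w
    rw [collectIntervals_cons_val]
    refine wellFormed_append.2 ⟨wellFormed_maxIntervals h1 h2, ih hws.2, fun p hp q hq => Or.inl ?_⟩
    rw [mem_maxIntervals h1 h2 hp]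
    exact hws.1 _ (mem_collectIntervals hT hs hq)

theorem covers_collectIntervals {T : NonemptyInterval ℕ} {cs : List (Fin n × ℕ)}
    (hT : ∀ c ∈ cs, T.fst ≤ c.2) (hs : (cs.map fun c => c.2).Pairwise (· ≤ ·))
    {ws : List (Fin n)} {u : Fin n} {τ : ℕ} :
    Covers Δ (collectIntervals Δ T cs ws).val u τ ↔
      u ∈ ws ∧ InWindow Δ T τ ∧ ∃ t ∈ (contactTimes u cs).val, τ ≤ t ∧ t ≤ τ + Δ := by
  induction ws with
  | nil => simp [collectIntervals]
  | cons w ws ih =>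
    rw [collectIntervals_cons_val, covers_append, ih,
      covers_maxIntervals (mem_contactTimes_le hT w) (pairwise_contactTimes hs w), List.mem_cons,
      or_and_right]
    refine or_congr_left (and_congr_right ?_)
    rintro rfl
    rfl

theorem collectIntervals_cost_le (T : NonemptyInterval ℕ) (cs : List (Fin n × ℕ))
    (ws : List (Fin n)) :
    (collectIntervals Δ T cs ws).cost ≤ ws.length * (3 * cs.length + 4) + 1 := by
  induction ws with
  | nil => simp [collectIntervals]
  | cons w ws ih =>
    have h1 := contactTimes_length_le w cs
    have h2 := maxIntervals_cost_le (Δ := Δ) T w (contactTimes w cs).val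
    have h3 := maxIntervals_length_le (Δ := Δ) T w (contactTimes w cs).val
    simp only [collectIntervals, Timed.cost_bind, Timed.cost_step, contactTimes_cost, concat_cost,
      List.length_cons]
    rw [add_mul]
    omega

/-- `N` is the array of all `Δ`-neighborhoods `N(v, T)` of the temporal graph `G`: the windows
covered by `N v` for the vertex `w` are those that contain a time-edge between `v` and `w`. -/
structure IsNeighborhoodArray (G : TemporalGraph (Fin n)) (Δ : ℕ) (N : Fin n → List (VIPair n)) :
    Prop where
  wellFormed : ∀ v, WellFormed Δ (N v)
  covers : ∀ v w τ, Covers Δ (N v) w τ ↔ InWindow Δ G.T τ ∧ (G.slice Δ τ).Adj v w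

theorem neighborhood_val (T : NonemptyInterval ℕ) (es : List (Fin n × Fin n × ℕ))
    (vs : List (Fin n)) (v : Fin n) :
    (neighborhood Δ T es vs v).val =
      if (contacts v es).val = [] then [] else
        (collectIntervals Δ T (contacts v es).val vs).val := by
  simp only [neighborhood, Timed.val_bind]
  cases (contacts v es).val <;> simp

theorem neighborhood_cost_le (T : NonemptyInterval ℕ) (es : List (Fin n × Fin n × ℕ))
    (vs : List (Fin n)) (v : Fin n) :
    (neighborhood Δ T es vs v).cost ≤
      es.length + 3 + 7 * (vs.length * (contacts v es).val.length) := by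
  simp only [neighborhood, Timed.cost_bind, Timed.cost_step, contacts_cost]
  cases h : (contacts v es).val with
  | nil => simp; omega
  | cons c cs =>
    have := collectIntervals_cost_le (Δ := Δ) T (c :: cs) vs
    simp only [List.length_cons] at this ⊢
    nlinarith

variable {G : TemporalGraph (Fin n)} {es : List (Fin n × Fin n × ℕ)}

theorem TemporalGraph.IsListedBy.length_eq (hes : G.IsListedBy es) : es.length = G.E.card := by
  rw [← List.length_map (f := fun e : Fin n × Fin n × ℕ => (s(e.1, e.2.1), e.2.2)),
    ← List.toFinset_card_of_nodup hes.1]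
  congr 1
  ext e
  rw [List.mem_toFinset, hes.2]

theorem TemporalGraph.IsListedBy.map_sortByTime (hes : G.IsListedBy es) (e : Sym2 (Fin n) × ℕ) :
    e ∈ (sortByTime es G.T.fst (G.T.snd - G.T.fst + 1)).val.map
      (fun e => (s(e.1, e.2.1), e.2.2)) ↔ e ∈ G.E := by
  rw [← hes.2]
  simp only [List.mem_map, mem_sortByTime]
  constructor
  · rintro ⟨a, ⟨h, -⟩, rfl⟩; exact ⟨a, h, rfl⟩
  · rintro ⟨a, h, rfl⟩
    have : G.T.fst ≤ a.2.2 ∧ a.2.2 ≤ G.T.snd :=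
      G.time_mem _ ((hes.2 _).1 (List.mem_map.2 ⟨a, h, rfl⟩))
    exact ⟨a, ⟨h, by omega, by omega⟩, rfl⟩

theorem TemporalGraph.IsListedBy.isNeighborhoodArray (hes : G.IsListedBy es) (Δ : ℕ) :
    IsNeighborhoodArray G Δ fun v => (neighborhood Δ G.T
      (sortByTime es G.T.fst (G.T.snd - G.T.fst + 1)).val (List.finRange n) v).val := by
  have hmap := hes.map_sortByTime
  have hmem := fun e h => (mem_sortByTime (es := es) (t := G.T.fst)
    (k := G.T.snd - G.T.fst + 1) (e := e)).1 h
  have hpw := pairwise_sortByTime es G.T.fst (G.T.snd - G.T.fst + 1)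
  generalize (sortByTime es G.T.fst (G.T.snd - G.T.fst + 1)).val = es' at hmap hmem hpw
  have hs : ∀ v, ((contacts v es').val.map fun c => c.2).Pairwise (· ≤ ·) := fun v =>
    (List.pairwise_map.2 hpw).sublist (contacts_sublist v es')
  have hT : ∀ v, ∀ c ∈ (contacts v es').val, G.T.fst ≤ c.2 := by
    intro v c hc
    obtain ⟨e, he, h⟩ := List.mem_map.1
      ((contacts_sublist v es').subset (List.mem_map_of_mem (f := fun c => c.2) hc))
    rw [← h]
    exact (hmem e he).2.1
  constructor
  · intro v
    rw [neighborhood_val]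
    split_ifs
    · exact wellFormed_nil
    · exact wellFormed_collectIntervals (hT v) (hs v) (List.pairwise_lt_finRange n)
  · intro v w τ
    have hadj : (G.slice Δ τ).Adj v w ↔
        ∃ t ∈ (contactTimes w (contacts v es').val).val, τ ≤ t ∧ t ≤ τ + Δ := by
      simp only [TemporalGraph.slice, mem_contactTimes_contacts, hmap]
      exact exists_congr fun t => by tauto
    rw [neighborhood_val, hadj]
    split_ifs with h
    · simp [h, contactTimes]
    · rw [covers_collectIntervals (hT v) (hs v)]
      simp

end Preprocessing

/-! ### Counting cliques and time-edges -/

theorem SimpleGraph.exists_ncard_neighborSet_le_degeneracy {V : Type*} [Finite V]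
    (H : SimpleGraph V) (K : H.Subgraph) (hK : K.verts.Nonempty) :
    ∃ v ∈ K.verts, (K.neighborSet v).ncard ≤ H.degeneracy := by
  have hne : {d : ℕ | ∀ K : H.Subgraph, K.verts.Nonempty →
      ∃ v ∈ K.verts, (K.neighborSet v).ncard ≤ d}.Nonempty := by
    refine ⟨Nat.card V, fun K hK => ?_⟩
    obtain ⟨v, hv⟩ := hK
    exact ⟨v, hv, Set.ncard_le_card _⟩
  exact Nat.sInf_mem hne K hK

open Classical in
/-- A set of `m` vertices of a graph of degeneracy at most `d` contains at most `m * 2 ^ d`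
non-empty cliques: at most `2 ^ d` of them contain a given vertex of degree at most `d`, and the
others live on the remaining vertices. -/
theorem SimpleGraph.card_cliques_le {V : Type*} [Finite V] (H : SimpleGraph V) {d : ℕ}
    (hd : H.degeneracy ≤ d) (U : Finset V) :
    (U.powerset.filter fun F : Finset V => F.Nonempty ∧ H.IsClique F).card ≤ U.card * 2 ^ d := by
  induction hm : U.card generalizing U with
  | zero =>
    rw [Finset.card_eq_zero] at hm
    subst hm
    simp
  | succ m ih =>
    have hU : U.Nonempty := Finset.card_pos.1 (by omega)
    obtain ⟨v, hv, hdeg⟩ := H.exists_ncard_neighborSet_le_degeneracy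
      ((⊤ : H.Subgraph).induce (U : Set V)) (by simpa using hU)
    have hvU : v ∈ U := by simpa using hv
    have hnb : (U.filter fun w => H.Adj v w).card ≤ d := by
      refine le_trans (le_of_eq ?_) (hdeg.trans hd)
      rw [← Set.ncard_coe_finset]
      congr 1
      ext w
      simp [hvU]
    have hsplit : (U.powerset.filter fun F : Finset V => F.Nonempty ∧ H.IsClique F) ⊆
        ((U.filter fun w => H.Adj v w).powerset.image fun F : Finset V => insert v F) ∪
          ((U.erase v).powerset.filter fun F : Finset V => F.Nonempty ∧ H.IsClique F) := by
      intro F hF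
      rw [Finset.mem_filter, Finset.mem_powerset] at hF
      obtain ⟨hFU, hne, hcl⟩ := hF
      rw [Finset.mem_union]
      by_cases hvF : v ∈ F
      · refine Or.inl (Finset.mem_image.2 ⟨F.erase v, ?_, Finset.insert_erase hvF⟩)
        rw [Finset.mem_powerset]
        intro w hw
        rw [Finset.mem_erase] at hw
        exact Finset.mem_filter.2 ⟨hFU hw.2, hcl hvF hw.2 hw.1.symm⟩
      · refine Or.inr (Finset.mem_filter.2 ⟨Finset.mem_powerset.2 fun w hw => ?_, hne, hcl⟩)
        exact Finset.mem_erase.2 ⟨fun h => hvF (h ▸ hw), hFU hw⟩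
    have h1 := ih (U.erase v) (by rw [Finset.card_erase_of_mem hvU, hm]; rfl)
    have h2 : ((U.filter fun w => H.Adj v w).powerset.image
        fun F : Finset V => insert v F).card ≤ 2 ^ d :=
      Finset.card_image_le.trans (by
        rw [Finset.card_powerset]
        exact Nat.pow_le_pow_right (by norm_num) hnb)
    calc _ ≤ _ := Finset.card_le_card hsplit
      _ ≤ _ := Finset.card_union_le _ _
      _ ≤ 2 ^ d + m * 2 ^ d := Nat.add_le_add h2 h1
      _ = (m + 1) * 2 ^ d := by ring

namespace TemporalGraph

variable {n : ℕ} {G : TemporalGraph (Fin n)} {Δ : ℕ}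

/-- The window `[τ, τ + Δ]` lies in the lifetime and contains a time-edge between any two vertices
of `F`. -/
def CliqueWindow (G : TemporalGraph (Fin n)) (Δ : ℕ) (F : Finset (Fin n)) (τ : ℕ) : Prop :=
  InWindow Δ G.T τ ∧ (G.slice Δ τ).IsClique F

/-- A time-maximal `Δ`-clique with a non-empty vertex set is determined by its starting point and
its vertex set, which is a clique of the `Δ`-slice at the starting point. -/
theorem card_timeMaximal_le {d : ℕ} (hd : G.HasSliceDegeneracy Δ d)
    (S : Finset (Finset (Fin n) × NonemptyInterval ℕ))
    (hS : ∀ R ∈ S, R.1.Nonempty ∧ IsRun Δ (G.CliqueWindow Δ R.1) R.2) :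
    S.card ≤ G.numTimes * (n * 2 ^ d) := by
  classical
  have hwin : ∀ R ∈ S, G.CliqueWindow Δ R.1 R.2.fst := fun R hR =>
    (hS R hR).2.holds _ (hS R hR).2.inWindow_fst
  rw [Finset.card_eq_sum_card_fiberwise (f := fun R => R.2.fst)
    (t := Finset.Icc G.T.fst G.T.snd) (fun R hR => ?_)]
  · rw [numTimes, ← smul_eq_mul]
    refine Finset.sum_le_card_nsmul _ _ _ fun a ha => ?_
    rw [Finset.mem_Icc] at ha
    have h := (G.slice Δ a).card_cliques_le (hd a ha) Finset.univ
    rw [Finset.card_univ, Fintype.card_fin] at h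
    refine le_trans (Finset.card_le_card_of_injOn (fun R => R.1) ?_ ?_) h
    · intro R hR
      rw [Finset.mem_coe, Finset.mem_filter] at hR
      obtain ⟨hR, rfl⟩ := hR
      simpa using ⟨(hS R hR).1, (hwin R hR).2⟩
    · intro R hR R' hR' heq
      simp only [Finset.coe_filter, Set.mem_ofPred_eq] at hR hR' heq
      have h1 := (hS R hR.1).2
      have h2 := (hS R' hR'.1).2
      rw [← heq] at h2
      refine Prod.ext heq (h1.eq_of_inWindow h2 h1.inWindow_fst ?_)
      rw [hR.2, ← hR'.2]
      exact h2.inWindow_fst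
  · have := (hwin R hR).1
    simp only [InWindow] at this
    simp only [Finset.coe_Icc, Set.mem_Icc]
    omega

/-- The number of pairs by which a `Δ`-clique on a non-empty vertex set `C` can be extended is at
most `2 * |E|`. If the interval of the pair `(w, J)` starts with `I`, then the pair is charged to
a time-edge between `w` and a fixed vertex of `C`; otherwise to the time-edge at time `J.fst + Δ`
that makes the first window of `J` good. -/
theorem length_le_of_covers {L : List (VIPair n)} (hL : WellFormed Δ L) {C : List (Fin n)}
    (hC : C ≠ []) {I : NonemptyInterval ℕ}
    (hcov : ∀ w τ, Covers Δ L w τ ↔ InWindow Δ I τ ∧ ∀ c ∈ C, (G.slice Δ τ).Adj c w) :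
    L.length ≤ 2 * G.E.card := by
  classical
  obtain ⟨c₀, hc₀⟩ := List.exists_mem_of_ne_nil C hC
  have hrun : ∀ p ∈ L, IsRun Δ (Covers Δ L p.1) p.2 := fun p hp => hL.isRun_of_mem hp
  have hfirst : ∀ p ∈ L, InWindow Δ I p.2.fst ∧ ∀ c ∈ C, (G.slice Δ p.2.fst).Adj c p.1 :=
    fun p hp => (hcov _ _).1 ((hrun p hp).holds _ (hrun p hp).inWindow_fst)
  have hnot : ∀ p ∈ L, p.1 ∉ C := fun p hp h => ((hfirst p hp).2 _ h).ne rfl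
  have hinj : ∀ p ∈ L, ∀ q ∈ L, p.1 = q.1 → p.2.fst = q.2.fst → p = q := by
    rintro ⟨v, J⟩ hp ⟨w, J'⟩ hq h1 h2
    simp only at h1 h2
    subst h1
    refine Prod.ext rfl ((hrun _ hp).eq_of_inWindow (hrun _ hq) (hrun _ hp).inWindow_fst ?_)
    simp only [h2]
    exact (hrun _ hq).inWindow_fst
  have hcard : L.toFinset.card ≤ (Finset.univ ×ˢ G.E : Finset (Bool × Sym2 (Fin n) × ℕ)).card := by
    refine Finset.card_le_card_of_forall_subsingleton
      (fun p x => (x.1 = true ∧ p.2.fst = I.fst ∧ x.2.1 = s(c₀, p.1)) ∨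
        (x.1 = false ∧ ∃ c ∈ C, x.2 = (s(c, p.1), p.2.fst + Δ))) ?_ ?_
    · intro p hp
      rw [List.mem_toFinset] at hp
      obtain ⟨hw, hadj⟩ := hfirst p hp
      by_cases h : p.2.fst = I.fst
      · obtain ⟨t, -, -, ht⟩ := hadj c₀ hc₀
        exact ⟨(true, _, t), by simpa using ht, Or.inl ⟨rfl, h, rfl⟩⟩
      · -- the window before `J` is inside `I`, so it misses some vertex of `C`
        have hlt : I.fst < p.2.fst := lt_of_le_of_ne hw.1 (Ne.symm h)
        have hb := (hrun p hp).before (p.2.fst - 1) (by omega)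
        rw [hcov] at hb
        have hw' : InWindow Δ I (p.2.fst - 1) := ⟨by omega, by have := hw.2; omega⟩
        simp only [hw', true_and, not_forall] at hb
        obtain ⟨c, hc, hb⟩ := hb
        obtain ⟨t, h1, h2, ht⟩ := hadj c hc
        have : t = p.2.fst + Δ := by
          by_contra hne
          exact hb ⟨t, by omega, by omega, ht⟩
        subst this
        exact ⟨(false, _, _), by simpa using ht, Or.inr ⟨rfl, c, hc, rfl⟩⟩
    · rintro ⟨b, e, t⟩ - p ⟨hp, hpx⟩ q ⟨hq, hqx⟩
      rw [List.mem_toFinset] at hp hq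
      simp only [Prod.mk.injEq] at hpx hqx
      rcases hpx with ⟨rfl, h1, h2⟩ | ⟨rfl, c, hc, h1, h2⟩
      · rcases hqx with ⟨-, h3, h4⟩ | ⟨h, -⟩
        · rw [h2, Sym2.congr_right] at h4
          exact hinj p hp q hq h4 (h1.trans h3.symm)
        · cases h
      · rcases hqx with ⟨h, -⟩ | ⟨-, c', hc', h3, h4⟩
        · cases h
        · refine hinj p hp q hq ?_ (by omega)
          rw [h1, Sym2.eq_iff] at h3
          rcases h3 with h3 | h3
          · exact h3.2
          · exact absurd (h3.1 ▸ hc) (hnot q hq)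
  rw [Finset.card_product, List.toFinset_card_of_nodup hL.nodup] at hcard
  simpa using hcard

/-- The vertices of a clique of a `Δ`-slice, except one, are joined to that one by different
time-edges. -/
theorem length_le_of_isClique {C : List (Fin n)} (hC : C.Nodup) {τ : ℕ}
    (hcl : (G.slice Δ τ).IsClique C.toFinset) : C.length ≤ G.E.card + 1 := by
  classical
  cases C with
  | nil => simp
  | cons c₀ C =>
    rw [List.nodup_cons] at hC
    rw [List.length_cons, add_le_add_iff_right, ← List.toFinset_card_of_nodup hC.2]
    refine Finset.card_le_card_of_forall_subsingleton (fun c e => e.1 = s(c₀, c)) ?_ ?_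
    · intro c hc
      rw [List.mem_toFinset] at hc
      obtain ⟨t, -, -, ht⟩ := hcl (by simp : c₀ ∈ _) (by simp [hc] : c ∈ _)
        (fun h => hC.1 (h ▸ hc))
      exact ⟨_, ht, rfl⟩
    · rintro e - c ⟨-, hc⟩ c' ⟨-, hc'⟩
      rwa [hc, Sym2.congr_right] at hc'

end TemporalGraph

/-! ### Maximal `Δ`-cliques and runs of clique windows -/

namespace TemporalGraph

variable {n : ℕ} {G : TemporalGraph (Fin n)} {Δ : ℕ}

theorem CliqueWindow.subset {F F' : Finset (Fin n)} {τ : ℕ} (h : G.CliqueWindow Δ F' τ)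
    (hF : F ⊆ F') : G.CliqueWindow Δ F τ :=
  ⟨h.1, h.2.subset (Finset.coe_subset.2 hF)⟩

theorem isDeltaClique_iff {R : Finset (Fin n) × NonemptyInterval ℕ} :
    G.IsDeltaClique Δ R ↔
      R.2.fst + Δ ≤ R.2.snd ∧ ∀ τ, InWindow Δ R.2 τ → G.CliqueWindow Δ R.1 τ := by
  constructor
  · rintro ⟨h1, h2, h3⟩
    refine ⟨h2, fun τ hτ => ⟨hτ.mono h1, fun v hv w hw hvw => h3 τ hτ.1 hτ.2 v hv w hw hvw⟩⟩
  · rintro ⟨h1, h2⟩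
    exact ⟨le_of_inWindow h1 fun τ hτ => (h2 τ hτ).1, h1,
      fun τ hτ hτ' v hv w hw hvw => (h2 τ ⟨hτ, hτ'⟩).2 hv hw hvw⟩

/-- The time-maximal `Δ`-cliques are the runs of clique windows. -/
theorem isRun_cliqueWindow_iff {R : Finset (Fin n) × NonemptyInterval ℕ} :
    IsRun Δ (G.CliqueWindow Δ R.1) R.2 ↔ G.IsDeltaClique Δ R ∧ G.IsTimeMaximal Δ R := by
  constructor
  · intro h
    refine ⟨isDeltaClique_iff.2 ⟨h.long, h.holds⟩, ?_⟩
    rintro ⟨R', hR', hlt, hsub⟩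
    refine hlt.not_ge (h.le_of_holds
      (fun τ hτ => ((isDeltaClique_iff.1 hR').2 τ hτ).subset hsub) (τ := R.2.fst) ?_ ?_)
    · exact h.inWindow_fst.mono hlt.le
    · exact h.inWindow_fst
  · rintro ⟨hc, hm⟩
    obtain ⟨hl, hw⟩ := isDeltaClique_iff.1 hc
    refine ⟨hl, hw, ?_, ?_⟩
    · intro τ hτ hcw
      refine hm ⟨(R.1, ⟨(τ, R.2.snd), by simp only; omega⟩), isDeltaClique_iff.2 ⟨?_, ?_⟩, ?_,
        subset_rfl⟩
      · simp only; omega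
      · rintro σ ⟨h1, h2⟩
        simp only at h1 h2
        rcases h1.eq_or_lt with rfl | h1
        · exact hcw
        · exact hw σ ⟨by omega, h2⟩
      · refine lt_of_le_not_ge (show τ ≤ R.2.fst ∧ R.2.snd ≤ R.2.snd from ⟨by omega, le_rfl⟩) ?_
        rintro (⟨h, -⟩ : R.2.fst ≤ τ ∧ R.2.snd ≤ R.2.snd)
        omega
    · intro τ hτ hcw
      refine hm ⟨(R.1, ⟨(R.2.fst, R.2.snd + 1), by simp only; omega⟩),
        isDeltaClique_iff.2 ⟨?_, ?_⟩, ?_, subset_rfl⟩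
      · simp only; omega
      · rintro σ ⟨h1, h2⟩
        simp only at h1 h2
        by_cases h : σ = τ
        · exact h ▸ hcw
        · exact hw σ ⟨h1, by omega⟩
      · refine lt_of_le_not_ge
          (show R.2.fst ≤ R.2.fst ∧ R.2.snd ≤ R.2.snd + 1 from ⟨le_rfl, by omega⟩) ?_
        rintro (⟨-, h⟩ : R.2.fst ≤ R.2.fst ∧ R.2.snd + 1 ≤ R.2.snd)
        omega

end TemporalGraph

/-! ### The recursion -/

section Recursion

variable {n : ℕ} {G : TemporalGraph (Fin n)} {Δ : ℕ}

/-- The invariant of the loop of `BronKerboschDelta` for `R = (C, I)`. The pairs of `P` and `X`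
together are all pairs that extend the time-maximal `Δ`-clique `(C, I)`: they cover those windows
of `I` in which a vertex has a time-edge to all the vertices of `C`. The vertices of `P` are larger
than those of `C`. -/
structure LoopInvariant (G : TemporalGraph (Fin n)) (Δ : ℕ) (C : List (Fin n))
    (I : NonemptyInterval ℕ) (P X : List (VIPair n)) : Prop where
  sorted : C.Pairwise (· > ·)
  isRun : IsRun Δ (G.CliqueWindow Δ C.toFinset) I
  wellFormed : WellFormed Δ (X.reverse ++ P)
  covers : ∀ w τ, Covers Δ (X.reverse ++ P) w τ ↔
    InWindow Δ I τ ∧ ∀ c ∈ C, (G.slice Δ τ).Adj c w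
  lt_of_mem : ∀ p ∈ P, ∀ c ∈ C, c < p.1

/-- The invariant of the calls of `BronKerboschDelta`: `P` holds the extensions by vertices larger
than all those of `C`, and `X` the others. -/
structure CallInvariant (G : TemporalGraph (Fin n)) (Δ : ℕ) (C : List (Fin n))
    (I : NonemptyInterval ℕ) (P X : List (VIPair n)) : Prop extends LoopInvariant G Δ C I P X where
  exists_lt : ∀ p ∈ X, ∃ c ∈ C, p.1 < c

/-- The pair `R` arises from `(C, I)` by adding vertices larger than those of `C` and shrinking the
interval. -/
def Below (C : List (Fin n)) (I : NonemptyInterval ℕ)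
    (R : Finset (Fin n) × NonemptyInterval ℕ) : Prop :=
  (∀ c ∈ C, c ∈ R.1) ∧ R.2 ≤ I ∧ ∀ w ∈ R.1, w ∉ C → ∀ c ∈ C, c < w

/-- The list contains every time-maximal `Δ`-clique with the property `S` exactly once, and nothing
else. -/
def EnumeratesTimeMaximal (G : TemporalGraph (Fin n)) (Δ : ℕ)
    (S : Finset (Fin n) × NonemptyInterval ℕ → Prop)
    (visited : List (List (Fin n) × NonemptyInterval ℕ)) : Prop :=
  (visited.map fun R => (R.1.toFinset, R.2)).Nodup ∧
    ∀ R : Finset (Fin n) × NonemptyInterval ℕ,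
      R ∈ visited.map (fun R => (R.1.toFinset, R.2)) ↔
        IsRun Δ (G.CliqueWindow Δ R.1) R.2 ∧ S R

open Classical in
/-- The maximal `Δ`-cliques of a list. -/
noncomputable def maximalCliques (G : TemporalGraph (Fin n)) (Δ : ℕ)
    (visited : List (List (Fin n) × NonemptyInterval ℕ)) :
    List (List (Fin n) × NonemptyInterval ℕ) :=
  visited.filter fun R => G.IsMaximalDeltaClique Δ (R.1.toFinset, R.2)

theorem maximalCliques_append (A B : List (List (Fin n) × NonemptyInterval ℕ)) :
    maximalCliques G Δ (A ++ B) = maximalCliques G Δ A ++ maximalCliques G Δ B :=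
  List.filter_append ..

theorem cliqueWindow_cons_iff {C : List (Fin n)} {v : Fin n} (hv : v ∉ C) {τ : ℕ} :
    G.CliqueWindow Δ (v :: C).toFinset τ ↔
      G.CliqueWindow Δ C.toFinset τ ∧ ∀ c ∈ C, (G.slice Δ τ).Adj c v := by
  rw [TemporalGraph.CliqueWindow, TemporalGraph.CliqueWindow, and_assoc, List.toFinset_cons,
    Finset.coe_insert, SimpleGraph.isClique_insert]
  refine and_congr_right fun _ => and_congr_right fun _ => ?_
  simp only [List.coe_toFinset, Set.mem_ofPred_eq]
  exact forall₂_congr fun c hc =>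
    ⟨fun h => (h fun h => hv (h ▸ hc)).symm, fun h _ => h.symm⟩

namespace LoopInvariant

variable {C : List (Fin n)} {I I' : NonemptyInterval ℕ} {P X : List (VIPair n)} {v : Fin n}

theorem nodup (h : LoopInvariant G Δ C I P X) : C.Nodup := h.sorted.imp fun h => h.ne'

theorem isRun_cons (h : LoopInvariant G Δ C I P X) (hv : (v, I') ∈ X.reverse ++ P) (hvC : v ∉ C) :
    IsRun Δ (G.CliqueWindow Δ (v :: C).toFinset) I' :=
  (h.isRun.and ((h.wellFormed.isRun_of_mem hv).congr fun τ => h.covers v τ)).congr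
    fun _ => (cliqueWindow_cons_iff hvC).symm

theorem notMem (h : LoopInvariant G Δ C I P X) (hv : (v, I') ∈ X.reverse ++ P) : v ∉ C := by
  intro hvC
  have hr := h.wellFormed.isRun_of_mem hv
  exact (((h.covers v _).1 (hr.holds _ hr.inWindow_fst)).2 v hvC).ne rfl

theorem le (h : LoopInvariant G Δ C I P X) {p : VIPair n} (hp : p ∈ X.reverse ++ P) : p.2 ≤ I :=
  have hr := h.wellFormed.isRun_of_mem (w := p.1) (J := p.2) hp
  le_of_inWindow hr.long fun τ hτ => ((h.covers _ τ).1 (hr.holds τ hτ)).1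

/-- Moving the processed pair from `P` to `X` preserves the invariant. -/
theorem move {p : VIPair n} (h : LoopInvariant G Δ C I (p :: P) X) :
    LoopInvariant G Δ C I P (p :: X) := by
  have e : (p :: X).reverse ++ P = X.reverse ++ p :: P := by simp
  exact ⟨h.sorted, h.isRun, e ▸ h.wellFormed, e ▸ h.covers,
    fun q hq => h.lt_of_mem q (List.mem_cons_of_mem _ hq)⟩

theorem separated_of_mem {p q : VIPair n} (h : LoopInvariant G Δ C I (p :: P) X) (hq : q ∈ X) :
    Separated Δ q p :=
  (wellFormed_append.1 h.wellFormed).2.2 q (List.mem_reverse.2 hq) p (by simp)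

/-- The lists that are passed to the recursive call for the pair `(v, I')` satisfy the invariant. -/
theorem callInvariant {N : Fin n → List (VIPair n)} (hN : IsNeighborhoodArray G Δ N)
    (h : LoopInvariant G Δ C I ((v, I') :: P) X) :
    CallInvariant G Δ (v :: C) I' (deltaCut Δ ((v, I') :: P) (restrictTo Δ I' (N v)).val).val
      (deltaCutDesc Δ X (restrictTo Δ I' (N v)).val).val := by
  have hv : (v, I') ∈ X.reverse ++ (v, I') :: P := by simp
  have hvC := h.notMem hv
  have hrun := h.isRun_cons hv hvC
  obtain ⟨wX, wP, hsep⟩ := wellFormed_append.1 h.wellFormed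
  have wM := (hN.wellFormed v).restrictTo I'
  have cM : ∀ w τ, Covers Δ (restrictTo Δ I' (N v)).val w τ ↔
      InWindow Δ I' τ ∧ (G.slice Δ τ).Adj v w := by
    intro w τ
    rw [covers_restrictTo, hN.covers]
    exact and_congr_right fun hτ => and_iff_right (hrun.holds τ hτ).1
  have hM : ∀ w J, (w, J) ∈ (restrictTo Δ I' (N v)).val → w ≠ v := by
    rintro w J hJ rfl
    have hr := wM.isRun_of_mem hJ
    exact ((cM _ _).1 (hr.holds _ hr.inWindow_fst)).2.ne rfl
  have hP : ∀ p ∈ (deltaCut Δ ((v, I') :: P) (restrictTo Δ I' (N v)).val).val, v < p.1 := by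
    intro p hp
    obtain ⟨J, J', h1, h2, -⟩ := mem_deltaCut hp
    have hne := hM _ _ h2
    rcases List.mem_cons.1 h1 with h1 | h1
    · exact absurd (Prod.mk.inj h1).1 hne
    · rcases (wellFormed_cons.1 wP).2.1 _ h1 with h3 | h3
      · exact h3
      · exact absurd h3.1.symm hne
  have hX : ∀ p ∈ (deltaCut Δ X.reverse (restrictTo Δ I' (N v)).val).val, p.1 < v := by
    intro p hp
    obtain ⟨J, J', h1, h2, -⟩ := mem_deltaCut hp
    rcases hsep _ h1 (v, I') (by simp) with h3 | h3
    · exact h3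
    · exact absurd h3.1 (hM _ _ h2)
  refine ⟨⟨List.pairwise_cons.2 ⟨h.lt_of_mem (v, I') (by simp), h.sorted⟩, hrun, ?_, ?_, ?_⟩, ?_⟩
  · rw [deltaCutDesc_val, List.reverse_reverse]
    exact wellFormed_append.2 ⟨wX.deltaCut wM, wP.deltaCut wM,
      fun p hp q hq => Or.inl ((hX p hp).trans (hP q hq))⟩
  · intro w τ
    rw [deltaCutDesc_val, List.reverse_reverse, covers_append, covers_deltaCut wX wM,
      covers_deltaCut wP wM, ← or_and_right, ← covers_append, h.covers, cM, List.forall_mem_cons]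
    constructor
    · rintro ⟨⟨-, h1⟩, h2, h3⟩
      exact ⟨h2, h3, h1⟩
    · rintro ⟨h1, h2, h3⟩
      exact ⟨⟨h1.mono (h.le hv), h3⟩, h1, h2⟩
  · intro p hp c hc
    rcases List.mem_cons.1 hc with rfl | hc
    · exact hP p hp
    · exact (h.lt_of_mem (v, I') (by simp) c hc).trans (hP p hp)
  · intro p hp
    rw [deltaCutDesc_val, List.mem_reverse] at hp
    exact ⟨v, by simp, hX p hp⟩

/-- `(C, I)` is a maximal `Δ`-clique if and only if no extension by a vertex keeps the interval. -/
theorem isMaximalDeltaClique_iff (h : LoopInvariant G Δ C I P X) :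
    G.IsMaximalDeltaClique Δ (C.toFinset, I) ↔ ∀ p ∈ X.reverse ++ P, p.2 ≠ I := by
  obtain ⟨hc, hm⟩ := TemporalGraph.isRun_cliqueWindow_iff (R := (C.toFinset, I)).1 h.isRun
  constructor
  · rintro ⟨-, hv, -⟩ ⟨w, J⟩ hp rfl
    have hr := h.isRun_cons hp (h.notMem hp)
    refine hv ⟨((w :: C).toFinset, J), TemporalGraph.isDeltaClique_iff.2 ⟨hr.long, hr.holds⟩,
      le_rfl, ?_⟩
    rw [List.toFinset_cons]
    exact Finset.ssubset_insert (by simpa using h.notMem hp)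
  · intro hne
    refine ⟨hc, ?_, hm⟩
    rintro ⟨⟨F, J⟩, hR, hIJ, hsub⟩
    obtain ⟨w, hw, hwC⟩ := Finset.exists_of_ssubset hsub
    rw [List.mem_toFinset] at hwC
    obtain ⟨J', hJ', hle⟩ := h.wellFormed.exists_le (w := w) h.isRun.long fun τ hτ => by
      refine (h.covers w τ).2 ⟨hτ, fun c hcC => ?_⟩
      exact ((TemporalGraph.isDeltaClique_iff.1 hR).2 τ (hτ.mono hIJ)).2
        (hsub.1 (List.mem_toFinset.2 hcC)) hw fun e => hwC (e ▸ hcC)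
    exact hne _ hJ' (le_antisymm (h.le hJ') hle)

end LoopInvariant

section Enumeration

variable {C : List (Fin n)} {I : NonemptyInterval ℕ} {P X : List (VIPair n)}

/-- Different pairs of `P` lead to different `Δ`-cliques: the vertex of the pair is the smallest one
that is added to `C`, and the intervals for one vertex have no common window. -/
theorem LoopInvariant.enumerates_cons {p : VIPair n} (h : LoopInvariant G Δ C I (p :: P) X)
    {vis₁ vis₂ : List (List (Fin n) × NonemptyInterval ℕ)}
    (h₁ : EnumeratesTimeMaximal G Δ (Below (p.1 :: C) p.2) vis₁)
    (h₂ : EnumeratesTimeMaximal G Δ (fun R => ∃ q ∈ P, Below (q.1 :: C) q.2 R) vis₂) :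
    EnumeratesTimeMaximal G Δ (fun R => ∃ q ∈ p :: P, Below (q.1 :: C) q.2 R) (vis₂ ++ vis₁) := by
  constructor
  · rw [List.map_append, List.nodup_append']
    refine ⟨h₂.1, h₁.1, fun R hR2 hR1 => ?_⟩
    obtain ⟨hrun, a1, a2, a3⟩ := (h₁.2 R).1 hR1
    obtain ⟨-, q, hq, b1, b2, b3⟩ := (h₂.2 R).1 hR2
    have hsep : Separated Δ p q :=
      (wellFormed_cons.1 (wellFormed_append.1 h.wellFormed).2.1).2.1 q hq
    obtain ⟨v, J⟩ := p
    obtain ⟨w, J'⟩ := q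
    have hvC : v ∉ C := h.notMem (I' := J) (by simp)
    by_cases hvw : v = w
    · subst hvw
      exact hsep.not_inWindow (hrun.inWindow_fst.mono a2) (hrun.inWindow_fst.mono b2)
    · rcases hsep with hlt | hlt
      · exact lt_asymm hlt (b3 v (a1 v (by simp)) (by simp [hvw, hvC]) w (by simp))
      · exact hvw hlt.1
  · intro R
    rw [List.map_append, List.mem_append, h₁.2, h₂.2, ← and_or_left]
    simp only [List.exists_mem_cons_iff]
    rw [or_comm]

theorem CallInvariant.enumerates (h : CallInvariant G Δ C I P X)
    {vis : List (List (Fin n) × NonemptyInterval ℕ)}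
    (hvis : EnumeratesTimeMaximal G Δ (fun R => ∃ q ∈ P, Below (q.1 :: C) q.2 R) vis) :
    EnumeratesTimeMaximal G Δ (Below C I) (vis ++ [(C, I)]) := by
  constructor
  · rw [List.map_append, List.nodup_append']
    refine ⟨hvis.1, by simp, fun R hR hR' => ?_⟩
    obtain ⟨-, ⟨v, J⟩, hq, hb, -⟩ := (hvis.2 R).1 hR
    simp only [List.map_cons, List.map_nil, List.mem_singleton] at hR'
    subst hR'
    exact h.notMem (I' := J) (List.mem_append_right _ hq) (by simpa using hb v (by simp))
  · rintro ⟨F, J⟩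
    rw [List.map_append, List.mem_append, hvis.2]
    simp only [List.map_cons, List.map_nil, List.mem_singleton, Prod.mk.injEq]
    constructor
    · rintro (⟨hrun, ⟨v, J'⟩, hq, h1, h2, h3⟩ | ⟨rfl, rfl⟩)
      · refine ⟨hrun, fun c hc => h1 c (by simp [hc]),
          h2.trans (h.le (List.mem_append_right _ hq)), fun w hw hwC c hc => ?_⟩
        by_cases hwv : w = v
        · subst hwv
          exact h.lt_of_mem _ hq c hc
        · exact h3 w hw (by simp [hwv, hwC]) c (by simp [hc])
      · exact ⟨h.isRun, by simp, le_rfl, fun w hw hwC => absurd (by simpa using hw) hwC⟩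
    · rintro ⟨hrun, h1, h2, h3⟩
      by_cases hF : F = C.toFinset
      · subst hF
        exact Or.inr ⟨rfl, hrun.eq_of_inWindow h.isRun hrun.inWindow_fst
          (hrun.inWindow_fst.mono h2)⟩
      · refine Or.inl ⟨hrun, ?_⟩
        -- the recursion reaches `F` through its smallest vertex outside `C`
        have hne : (F \ C.toFinset).Nonempty := by
          rw [Finset.sdiff_nonempty]
          exact fun hs => hF (hs.antisymm fun c hc => h1 c (List.mem_toFinset.1 hc))
        obtain ⟨v, hv, hmin⟩ := Finset.exists_min_image _ id hne
        simp only [Finset.mem_sdiff, List.mem_toFinset, id] at hv hmin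
        obtain ⟨J', hJ', hle⟩ := h.wellFormed.exists_le (w := v) hrun.long fun τ hτ =>
          (h.covers v τ).2 ⟨hτ.mono h2, fun c hc =>
            (hrun.holds τ hτ).2 (h1 c hc) hv.1 fun e => hv.2 (e ▸ hc)⟩
        rcases List.mem_append.1 hJ' with hX | hP
        · obtain ⟨c, hc, hlt⟩ := h.exists_lt _ (List.mem_reverse.1 hX)
          exact absurd hlt (h3 v hv.1 hv.2 c hc).not_gt
        · refine ⟨(v, J'), hP, ?_, hle, ?_⟩
          · simpa using ⟨hv.1, h1⟩
          · intro w hw hwC c hc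
            simp only [List.mem_cons, not_or] at hwC hc
            rcases hc with rfl | hc
            · exact lt_of_le_of_ne (hmin w ⟨hw, hwC.2⟩) (Ne.symm hwC.1)
            · exact h3 w hw hwC.2 c hc

end Enumeration

/-! ### Correctness and cost of the recursion -/

theorem Comp.lift_bind {α β : Type} (x : Timed α) (f : α → Comp β) (c : ℕ) :
    ((liftM x : Comp α) >>= f) c = f x.val (c + x.cost) := rfl

theorem Comp.bind_eq_of_eq_some {α β : Type} {m : Comp α} {f : α → Comp β} {a : α} {c c' : ℕ}
    (h : m c = some (a, c')) : (m >>= f) c = f a c' := by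
  show (m c).bind _ = _
  rw [h]
  rfl

/-- What a part `m` of the recursion does, whatever the solution `sol` and the step count `c` it
starts with: it visits exactly the time-maximal `Δ`-cliques with the property `S`, each once, adds
the maximal ones to the solution, and takes a number of steps that satisfies `bound` together with
the number of visited `Δ`-cliques. -/
def Explores (G : TemporalGraph (Fin n)) (Δ : ℕ)
    (S : Finset (Fin n) × NonemptyInterval ℕ → Prop) (bound : ℕ → ℕ → Prop)
    (m : List (List (Fin n) × NonemptyInterval ℕ) →
      Comp (List (List (Fin n) × NonemptyInterval ℕ))) : Prop :=
  ∀ sol c, ∃ visited k, m sol c = some (maximalCliques G Δ visited ++ sol, c + k) ∧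
    EnumeratesTimeMaximal G Δ S visited ∧ bound k visited.length

theorem explores_loop {N : Fin n → List (VIPair n)} (hN : IsNeighborhoodArray G Δ N)
    {call : List (VIPair n) → List (Fin n) × NonemptyInterval ℕ → List (VIPair n) →
      List (List (Fin n) × NonemptyInterval ℕ) → Comp (List (List (Fin n) × NonemptyInterval ℕ))}
    {C : List (Fin n)} {A B : ℕ}
    (hcall : ∀ v I P X, CallInvariant G Δ (v :: C) I P X →
      Explores G Δ (Below (v :: C) I) (fun k m => k + B ≤ A * m) (call P (v :: C, I) X))
    {I : NonemptyInterval ℕ} {P X : List (VIPair n)} (h : LoopInvariant G Δ C I P X) :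
    Explores G Δ (fun R => ∃ q ∈ P, Below (q.1 :: C) q.2 R)
      (fun k m => k + B * P.length ≤
        1 + (P.map fun p => roundCost (N p.1) (X.length + P.length)).sum + A * m)
      (bronKerboschDeltaLoop Δ N call C P X) := by
  induction P generalizing X with
  | nil =>
    intro sol c
    exact ⟨[], 1, rfl, ⟨by simp, by simp⟩, by simp⟩
  | cons p P ih =>
    obtain ⟨v, I'⟩ := p
    intro sol c
    have hcost := round_cost_le (Δ := Δ) I' (N v) ((v, I') :: P) X
    have hins : insertDesc (v, I') X = ⟨(v, I') :: X, 1⟩ := insertDesc_eq_cons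
      (fun q hq => h.separated_of_mem hq)
      fun q hq => h.wellFormed.long q (List.mem_append_left _ (List.mem_reverse.2 hq))
    obtain ⟨vis₁, k₁, e₁, v₁, b₁⟩ := hcall _ _ _ _ (h.callInvariant hN) sol
      (c + 1 + (restrictTo Δ I' (N v)).cost +
        (deltaCut Δ ((v, I') :: P) (restrictTo Δ I' (N v)).val).cost +
        (deltaCutDesc Δ X (restrictTo Δ I' (N v)).val).cost)
    obtain ⟨vis₂, k₂, e₂, v₂, b₂⟩ := ih h.move (maximalCliques G Δ vis₁ ++ sol)
      (c + 1 + (restrictTo Δ I' (N v)).cost +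
        (deltaCut Δ ((v, I') :: P) (restrictTo Δ I' (N v)).val).cost +
        (deltaCutDesc Δ X (restrictTo Δ I' (N v)).val).cost + k₁ + 1)
    refine ⟨vis₂ ++ vis₁, 1 + (restrictTo Δ I' (N v)).cost +
        (deltaCut Δ ((v, I') :: P) (restrictTo Δ I' (N v)).val).cost +
        (deltaCutDesc Δ X (restrictTo Δ I' (N v)).val).cost + k₁ + 1 + k₂, ?_,
      h.enumerates_cons v₁ v₂, ?_⟩
    · rw [bronKerboschDeltaLoop, Comp.lift_bind, Comp.lift_bind, Comp.lift_bind, Comp.lift_bind,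
        Timed.cost_step, Comp.bind_eq_of_eq_some e₁, Comp.lift_bind, hins, e₂,
        maximalCliques_append, List.append_assoc]
      congr 2
      omega
    · have e : ((v, I') :: X).length + P.length = X.length + ((v, I') :: P).length := by
        simp only [List.length_cons]; omega
      rw [e] at b₂
      generalize X.length + ((v, I') :: P).length = ℓ at hcost b₂ ⊢
      simp only [List.map_cons, List.sum_cons, List.length_append, List.length_cons, mul_add,
        mul_one]
      omega

/-- A call whose loop takes `k` steps itself takes `|P| + |X| + |C| + 4` further steps at most. -/
theorem explores_succ {N : Fin n → List (VIPair n)} {depth : ℕ} {C : List (Fin n)}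
    {I : NonemptyInterval ℕ} {P X : List (VIPair n)} (h : CallInvariant G Δ C I P X)
    {bound : ℕ → ℕ → Prop}
    (hloop : Explores G Δ (fun R => ∃ q ∈ P, Below (q.1 :: C) q.2 R) bound
      (bronKerboschDeltaLoop Δ N (bronKerboschDeltaAux Δ N depth) C P X)) :
    Explores G Δ (Below C I)
      (fun k m => ∃ k' m', bound k' m' ∧ m = m' + 1 ∧
        k ≤ k' + (X.length + P.length + C.length + 4))
      (bronKerboschDeltaAux Δ N (depth + 1) P (C, I) X) := by
  intro sol c
  have hP := allProper_val fun p hp => h.le (List.mem_append_right X.reverse hp)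
  have hX := allProper_val fun p hp => h.le (List.mem_append_left P (List.mem_reverse.2 hp))
  have hcP := allProper_cost_le I P
  have hcX := allProper_cost_le I X
  have hmax : ((allProper I P).val && (allProper I X).val) = true ↔
      G.IsMaximalDeltaClique Δ (C.toFinset, I) := by
    rw [h.isMaximalDeltaClique_iff, Bool.and_eq_true, hP, hX]
    simp only [List.mem_append, List.mem_reverse, or_imp, forall_and]
    exact and_comm
  rw [bronKerboschDeltaAux, Comp.lift_bind, Comp.lift_bind, Comp.lift_bind, Timed.cost_step]
  split_ifs with hc
  · rw [Comp.lift_bind, concat_val, concat_cost, List.append_nil]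
    obtain ⟨vis, k, e, hv, hb⟩ := hloop ((C, I) :: sol)
      (c + 1 + (allProper I P).cost + (allProper I X).cost + (C.length + 1))
    refine ⟨vis ++ [(C, I)], 1 + (allProper I P).cost + (allProper I X).cost + (C.length + 1) + k,
      ?_, h.enumerates hv, k, _, hb, by simp, by omega⟩
    have : maximalCliques G Δ [(C, I)] = [(C, I)] := by
      rw [maximalCliques, List.filter_singleton]
      simp [hmax.1 hc]
    rw [e, maximalCliques_append, this, List.append_assoc, List.singleton_append]
    congr 2
    omega
  · obtain ⟨vis, k, e, hv, hb⟩ := hloop sol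
      (c + 1 + (allProper I P).cost + (allProper I X).cost)
    refine ⟨vis ++ [(C, I)], 1 + (allProper I P).cost + (allProper I X).cost + k,
      ?_, h.enumerates hv, k, _, hb, by simp, by omega⟩
    have : maximalCliques G Δ [(C, I)] = [] := by
      rw [maximalCliques, List.filter_singleton]
      simp [hmax.not.1 hc]
    rw [e, maximalCliques_append, this, List.append_nil]
    congr 2
    omega

theorem IsNeighborhoodArray.length_le {N : Fin n → List (VIPair n)}
    (hN : IsNeighborhoodArray G Δ N) (v : Fin n) : (N v).length ≤ 2 * G.E.card :=
  TemporalGraph.length_le_of_covers (hN.wellFormed v) (List.cons_ne_nil v []) (I := G.T)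
    fun w τ => by simp [hN.covers]

theorem roundCost_le {N : Fin n → List (VIPair n)} (hN : IsNeighborhoodArray G Δ N) (v : Fin n)
    {ℓ : ℕ} (hℓ : ℓ ≤ 2 * G.E.card) : roundCost (N v) ℓ ≤ 8 + 14 * G.E.card := by
  have := hN.length_le v
  unfold roundCost
  split_ifs <;> omega

theorem CallInvariant.length_lt {C : List (Fin n)} {I : NonemptyInterval ℕ}
    {P X : List (VIPair n)} (h : CallInvariant G Δ C I P X) : C.length < n + 1 := by
  simpa [Nat.lt_succ_iff] using h.nodup.length_le_card

/-- Below the root of the recursion, every call takes `O(|E|)` steps, apart from the calls it makes.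
The `8 + 14 * |E|` steps that a caller spends on preparing a call are accounted for by that
call. -/
theorem explores_aux {N : Fin n → List (VIPair n)} (hN : IsNeighborhoodArray G Δ N) (depth : ℕ)
    {C : List (Fin n)} (hC : C ≠ []) (hdepth : C.length + depth = n + 1)
    {I : NonemptyInterval ℕ} {P X : List (VIPair n)} (h : CallInvariant G Δ C I P X) :
    Explores G Δ (Below C I)
      (fun k m => k + (8 + 14 * G.E.card) ≤ (14 + 17 * G.E.card) * m)
      (bronKerboschDeltaAux Δ N depth P (C, I) X) := by
  induction depth generalizing C I P X with
  | zero =>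
    have := h.length_lt
    omega
  | succ depth ih =>
    have hlen : X.length + P.length ≤ 2 * G.E.card := by
      simpa using TemporalGraph.length_le_of_covers h.wellFormed hC h.covers
    have hClen : C.length ≤ G.E.card + 1 := TemporalGraph.length_le_of_isClique h.nodup
      (h.isRun.holds _ h.isRun.inWindow_fst).2
    have hloop := explores_loop hN
      (fun v I P X h' => ih (List.cons_ne_nil v C) (by simp only [List.length_cons]; omega) h')
      h.toLoopInvariant
    have hsum : (P.map fun p => roundCost (N p.1) (X.length + P.length)).sum ≤
        (8 + 14 * G.E.card) * P.length := by
      rw [mul_comm, ← smul_eq_mul]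
      refine (List.sum_le_card_nsmul _ (8 + 14 * G.E.card) ?_).trans_eq (by rw [List.length_map])
      intro x hx
      obtain ⟨p, -, rfl⟩ := List.mem_map.1 hx
      exact roundCost_le hN _ hlen
    intro sol c
    obtain ⟨vis, k, e, hv, k', m', hb, hm, hk⟩ := explores_succ h hloop sol c
    refine ⟨vis, k, e, hv, ?_⟩
    show k + (8 + 14 * G.E.card) ≤ (14 + 17 * G.E.card) * vis.length
    rw [hm, mul_add, mul_one]
    omega

end Recursion

/-! ### The whole computation -/

section Computation

variable {n : ℕ} {G : TemporalGraph (Fin n)} {Δ : ℕ}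

theorem callInvariant_root (hT : G.T.fst + Δ ≤ G.T.snd) :
    CallInvariant G Δ [] G.T ((List.finRange n).map fun v => (v, G.T)) [] := by
  refine ⟨⟨List.Pairwise.nil, ⟨hT, fun τ hτ => ⟨hτ, by simp⟩, ?_, ?_⟩, ⟨?_, ?_⟩, ?_, by simp⟩,
    by simp⟩
  · rintro τ hτ ⟨⟨h, -⟩, -⟩
    omega
  · rintro τ hτ ⟨⟨-, h⟩, -⟩
    omega
  · intro p hp
    obtain ⟨v, -, rfl⟩ := List.mem_map.1 ((List.mem_append.1 hp).resolve_left (by simp))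
    exact hT
  · simp only [List.reverse_nil, List.nil_append, List.pairwise_map]
    exact (List.pairwise_lt_finRange n).imp Or.inl
  · intro w τ
    simp [Covers]

/-- A bound for the number of calls: besides the root there is one for each time-maximal `Δ`-clique
with at least one vertex. -/
theorem length_visited_le {d : ℕ} (hd : G.HasSliceDegeneracy Δ d)
    {vis : List (List (Fin n) × NonemptyInterval ℕ)} {S} (h : EnumeratesTimeMaximal G Δ S vis) :
    vis.length ≤ G.numTimes * (n * 2 ^ d) + 1 := by
  classical
  set V := (vis.map fun R => (R.1.toFinset, R.2)).toFinset with hV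
  have hrun : ∀ R ∈ V, IsRun Δ (G.CliqueWindow Δ R.1) R.2 := fun R hR =>
    ((h.2 R).1 (List.mem_toFinset.1 hR)).1
  have hcard : V.card = vis.length := by
    rw [hV, List.toFinset_card_of_nodup h.1, List.length_map]
  have h1 := TemporalGraph.card_timeMaximal_le hd (V.filter fun R => R.1.Nonempty) fun R hR =>
    ⟨(Finset.mem_filter.1 hR).2, hrun R (Finset.mem_filter.1 hR).1⟩
  have h2 : (V.filter fun R => ¬ R.1.Nonempty).card ≤ 1 := by
    rw [Finset.card_le_one]
    -- with an empty vertex set, the lifetime is the only time-maximal `Δ`-clique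
    have key : ∀ R ∈ V.filter fun R => ¬ R.1.Nonempty, R = (∅, G.T) := by
      rintro ⟨F, J⟩ hR
      rw [Finset.mem_filter, Finset.not_nonempty_iff_eq_empty] at hR
      obtain ⟨hR, rfl⟩ := hR
      have hJ := hrun _ hR
      have hle : J ≤ G.T := le_of_inWindow hJ.long fun τ hτ => (hJ.holds τ hτ).1
      refine Prod.ext rfl (le_antisymm hle ?_)
      exact hJ.le_of_holds (fun τ hτ => ⟨hτ, by simp⟩) (hJ.inWindow_fst.mono hle)
        hJ.inWindow_fst
    intro R hR R' hR'
    rw [key R hR, key R' hR']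
  have h3 := Finset.card_filter_add_card_filter_not (s := V) fun R => R.1.Nonempty
  omega

theorem sum_roundCost_le {N : Fin n → List (VIPair n)} (hN : IsNeighborhoodArray G Δ N)
    {a : Fin n → ℕ} (ha : ∀ v, N v ≠ [] → 1 ≤ a v) (hsum : ∑ v, a v ≤ 2 * G.E.card) :
    ∑ v, roundCost (N v) n ≤ 8 * n + 14 * (n * G.E.card) := by
  calc ∑ v, roundCost (N v) n ≤ ∑ v, (8 + 8 * G.E.card + 3 * n * a v) := by
        refine Finset.sum_le_sum fun v _ => ?_
        have h1 := hN.length_le v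
        unfold roundCost
        split_ifs with h
        · omega
        · have := Nat.mul_le_mul_left (3 * n) (ha v h)
          omega
    _ = n * (8 + 8 * G.E.card) + 3 * n * ∑ v, a v := by
        rw [Finset.sum_add_distrib, ← Finset.mul_sum]
        simp
    _ ≤ n * (8 + 8 * G.E.card) + 3 * n * (2 * G.E.card) := by gcongr
    _ = 8 * n + 14 * (n * G.E.card) := by ring

theorem tabulate_neighborhood_cost_le {es : List (Fin n × Fin n × ℕ)} (T : NonemptyInterval ℕ) :
    (tabulate (neighborhood Δ T es (List.finRange n))).cost ≤
      4 * n + 15 * (n * es.length) := by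
  calc (tabulate (neighborhood Δ T es (List.finRange n))).cost
      ≤ ∑ v, (es.length + 4 + 7 * n * (contacts v es).val.length) := by
        show ∑ v, ((neighborhood Δ T es (List.finRange n) v).cost + 1) ≤ _
        refine Finset.sum_le_sum fun v _ => ?_
        have := neighborhood_cost_le (Δ := Δ) T es (List.finRange n) v
        rw [List.length_finRange, ← mul_assoc] at this
        omega
    _ = n * (es.length + 4) + 7 * n * ∑ v, (contacts v es).val.length := by
        rw [Finset.sum_add_distrib, ← Finset.mul_sum]
        simp
    _ ≤ n * (es.length + 4) + 7 * n * (2 * es.length) := by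
        gcongr
        exact sum_contacts_length_le es
    _ = 4 * n + 15 * (n * es.length) := by ring

/-- Correctness of the algorithm, and a bound for its running time that also holds for temporal
graphs without vertices or time-edges. -/
theorem bronKerboschDelta_spec {d : ℕ} {es : List (Fin n × Fin n × ℕ)} (hes : G.IsListedBy es)
    (hT : G.T.fst + Δ ≤ G.T.snd) (hd : G.HasSliceDegeneracy Δ d) :
    ∃ (sol : List (List (Fin n) × NonemptyInterval ℕ)) (steps : ℕ),
      bronKerboschDelta Δ G.T es = some (sol, steps) ∧
      G.EnumeratesMaximalDeltaCliques Δ sol ∧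
      steps ≤ 60 * (2 ^ d * (G.numTimes * (n + 1) * (G.E.card + 1))) := by
  set es' := sortByTime es G.T.fst (G.T.snd - G.T.fst + 1) with hes'
  set N := tabulate (neighborhood Δ G.T es'.val (List.finRange n)) with hNdef
  have hN : IsNeighborhoodArray G Δ N.val := hes.isNeighborhoodArray Δ
  have hcard := hes.length_eq
  have hlen : es'.val.length ≤ G.E.card := hcard ▸ sortByTime_length_le ..
  have hroot := callInvariant_root hT
  have hloop := explores_loop hN (fun v I P X h =>
    explores_aux hN n (List.cons_ne_nil v []) (by simp [add_comm]) h) hroot.toLoopInvariant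
  obtain ⟨vis, k, e, hv, k', m', hb, hm, hk⟩ := explores_succ hroot hloop []
    (0 + es'.cost + (n + 1) + N.cost + (n + 1))
  refine ⟨maximalCliques G Δ vis, 0 + es'.cost + (n + 1) + N.cost + (n + 1) + k, ?_, ?_, ?_⟩
  · rw [List.append_nil] at e
    rw [← e, bronKerboschDelta, bronKerboschDeltaComp, StateT.run, Comp.lift_bind, Comp.lift_bind,
      Comp.lift_bind, Comp.lift_bind, initialPairs_val, initialPairs_cost]
    simp only [vertexList, List.length_finRange]
    rfl
  · constructor
    · exact hv.1.sublist (List.filter_sublist.map _)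
    · intro R
      have hmem := hv.2 R
      constructor
      · intro hR
        obtain ⟨R', hR', rfl⟩ := List.mem_map.1 hR
        simpa using (List.mem_filter.1 hR').2
      · intro hR
        have hrun := TemporalGraph.isRun_cliqueWindow_iff.2 ⟨hR.1, hR.2.2⟩
        obtain ⟨R', hR', rfl⟩ := List.mem_map.1
          (hmem.2 ⟨hrun, by simp, le_of_inWindow hrun.long fun τ hτ => (hrun.holds τ hτ).1,
            by simp⟩)
        exact List.mem_map.2 ⟨R', List.mem_filter.2 ⟨hR', by simpa using hR⟩, rfl⟩
  · have hsort : es'.cost ≤ G.numTimes * (2 * G.E.card + 3) + 1 := by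
      have hnum : G.T.snd - G.T.fst + 1 = G.numTimes := by
        rw [TemporalGraph.numTimes, Nat.card_Icc]
        omega
      rw [← hcard, ← hnum]
      exact sortByTime_cost_le ..
    have hNcost : N.cost ≤ 4 * n + 15 * (n * G.E.card) :=
      (tabulate_neighborhood_cost_le G.T).trans (by gcongr)
    have hround := sum_roundCost_le hN (a := fun v => (contacts v es'.val).val.length)
      (fun v hNv => by
        rw [Nat.one_le_iff_ne_zero, ne_eq, List.length_eq_zero_iff]
        intro h
        exact hNv (by rw [hNdef]; simp [tabulate, neighborhood_val, h]))
      ((sum_contacts_length_le _).trans (by gcongr))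
    rw [List.map_map] at hb
    simp only [List.length_map, List.length_finRange, List.length_nil, zero_add] at hb hk
    have hround' : ((List.finRange n).map ((fun p : VIPair n => roundCost (N.val p.1) n) ∘
        fun v => (v, G.T))).sum = ∑ v, roundCost (N.val v) n := (Fin.sum_univ_def _).symm
    rw [hround'] at hb
    have hm' : m' ≤ G.numTimes * (n * 2 ^ d) := by
      have := length_visited_le hd hv
      omega
    have h1 := Nat.mul_le_mul_left (14 + 17 * G.E.card) hm'
    have hT1 : 1 ≤ G.numTimes := by
      rw [TemporalGraph.numTimes, Nat.card_Icc]
      omega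
    have hd1 : 1 ≤ 2 ^ d := Nat.one_le_two_pow
    have hsteps : 0 + es'.cost + (n + 1) + N.cost + (n + 1) + k ≤
        G.numTimes * (2 * G.E.card + 3) + 8 + 15 * n + 29 * (n * G.E.card) +
          (14 + 17 * G.E.card) * (G.numTimes * (n * 2 ^ d)) := by
      omega
    refine hsteps.trans ?_
    generalize G.numTimes = t at *
    generalize G.E.card = m at *
    generalize 2 ^ d = D at *
    have a1 : t * (2 * m + 3) ≤ 3 * (D * (t * (n + 1) * (m + 1))) := by
      calc t * (2 * m + 3) ≤ 1 * (t * 1 * (3 * (m + 1))) := by rw [one_mul, mul_one]; gcongr; omega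
        _ ≤ D * (t * (n + 1) * (3 * (m + 1))) := by gcongr; omega
        _ = _ := by ring
    have a2 : 8 + 15 * n + 29 * (n * m) ≤ 29 * (D * (t * (n + 1) * (m + 1))) := by
      calc 8 + 15 * n + 29 * (n * m) ≤ 29 * (1 * (1 * (n + 1) * (m + 1))) := by ring_nf; omega
        _ ≤ _ := by gcongr
    have a3 : (14 + 17 * m) * (t * (n * D)) ≤ 17 * (D * (t * (n + 1) * (m + 1))) := by
      calc (14 + 17 * m) * (t * (n * D)) ≤ (17 * (m + 1)) * (t * ((n + 1) * D)) := by
            gcongr <;> omega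
        _ = _ := by ring
    omega

end Computation

theorem mainTheorem3 :
    -- correctness and the running time `O(3^{d/3} * 2^d * |V| * |T| * |E|)`
    (∃ K : ℝ, ∀ (n : ℕ) (G : TemporalGraph (Fin n)) (Δ d : ℕ) (es : List (Fin n × Fin n × ℕ)),
      G.IsListedBy es → G.T.fst + Δ ≤ G.T.snd → G.HasSliceDegeneracy Δ d →
      ∃ (sol : List (List (Fin n) × NonemptyInterval ℕ)) (steps : ℕ),
        bronKerboschDelta Δ G.T es = some (sol, steps) ∧
        G.EnumeratesMaximalDeltaCliques Δ sol ∧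
        (G.E.Nonempty →
          (steps : ℝ) ≤ K * ((3 : ℝ) ^ ((d : ℝ) / 3) * 2 ^ d * n * G.numTimes * G.E.card))) ∧
    -- fixed-parameter tractability with respect to the parameter `d`
    (∃ (f : ℕ → ℕ) (c : ℕ), Computable f ∧
      ∀ (n : ℕ) (G : TemporalGraph (Fin n)) (Δ d : ℕ) (es : List (Fin n × Fin n × ℕ)),
      G.IsListedBy es → G.T.fst + Δ ≤ G.T.snd → G.HasSliceDegeneracy Δ d →
      ∃ (sol : List (List (Fin n) × NonemptyInterval ℕ)) (steps : ℕ),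
        bronKerboschDelta Δ G.T es = some (sol, steps) ∧
        G.EnumeratesMaximalDeltaCliques Δ sol ∧
        steps ≤ f d * (n + G.numTimes + G.E.card) ^ c) := by
  constructor
  · refine ⟨240, fun n G Δ d es hes hT hd => ?_⟩
    obtain ⟨sol, steps, h1, h2, h3⟩ := bronKerboschDelta_spec hes hT hd
    refine ⟨sol, steps, h1, h2, fun hE => ?_⟩
    have hm : 1 ≤ G.E.card := hE.card_pos
    have hn : 1 ≤ n := by
      obtain ⟨⟨e, t⟩, -⟩ := hE
      induction e with
      | _ v w => exact v.pos
    have h4 : steps ≤ 240 * (2 ^ d * n * G.numTimes * G.E.card) :=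
      calc steps ≤ _ := h3
        _ ≤ 60 * (2 ^ d * (G.numTimes * (2 * n) * (2 * G.E.card))) := by gcongr <;> omega
        _ = _ := by ring
    have h5 : (1 : ℝ) ≤ (3 : ℝ) ^ ((d : ℝ) / 3) :=
      Real.one_le_rpow (by norm_num) (by positivity)
    calc (steps : ℝ) ≤ 240 * (1 * 2 ^ d * n * G.numTimes * G.E.card) := by
          rw [one_mul]; exact_mod_cast h4
      _ ≤ _ := by gcongr
  · refine ⟨fun d => 60 * 2 ^ d, 3, ?_, fun n G Δ d es hes hT hd => ?_⟩
    · have h : Primrec fun d : ℕ => 60 * 2 ^ d := by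
        have := Primrec.nat_rec₁ (f := fun _ x => 2 * x) 60
          ((Primrec.nat_mul.comp (Primrec.const 2) Primrec.snd).to₂)
        refine this.of_eq fun d => ?_
        induction d with
        | zero => rfl
        | succ d ih => simp only [ih]; ring
      exact h.to_comp
    · obtain ⟨sol, steps, h1, h2, h3⟩ := bronKerboschDelta_spec hes hT hd
      refine ⟨sol, steps, h1, h2, h3.trans ?_⟩
      have hT1 : 1 ≤ G.numTimes := by
        rw [TemporalGraph.numTimes, Nat.card_Icc]
        omega
      have b1 : G.numTimes ≤ n + G.numTimes + G.E.card := by omega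
      have b2 : n + 1 ≤ n + G.numTimes + G.E.card := by omega
      have b3 : G.E.card + 1 ≤ n + G.numTimes + G.E.card := by omega
      calc 60 * (2 ^ d * (G.numTimes * (n + 1) * (G.E.card + 1)))
          ≤ 60 * (2 ^ d * ((n + G.numTimes + G.E.card) * (n + G.numTimes + G.E.card) *
              (n + G.numTimes + G.E.card))) := by gcongr
        _ = _ := by ring
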